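/- **Setting.** Let $\|\cdot\|$ be a norm on $\mathbb R^d$ with dual norm $\|y\|_*=\sup_{\|u\|\le1}\langle y,u\rangle$, let $\rho=\sup_{z\neq0}\|z\|_*/\|z\|_2$, and let $\mathrm{lmo}$ be a (measurable) map with $\mathrm{lmo}(0)=0$ and $\mathrm{lmo}(y)\in\arg\min_{\|u\|\le1}\langle y,u\rangle$ for $y\ne0$. Let $f(x)=\mathbb E_{\xi\sim\mathcal D}[f(x;\xi)]$ be differentiable, where each $f(\cdot;\xi)$ is differentiable, and assume for all $x,y\in\mathbb R^d$: (i) $f(x)\ge f^*>-\infty$; (ii) $\mathbb E[\nabla f(x;\xi)]=\nabla f(x)$ and $\mathbb E\|\nabla f(x;\xi)-\nabla f(x)\|_2^2\le\sigma^2$, where $\sigma\ge0$; (iii) for constants $L_0,L_1\ge0$, $\|\nabla f(x)-\nabla f(y)\|_*\le\sup_{\theta\in[0,1]}\big(L_0+L_1\|\nabla f(\theta x+(1-\theta)y)\|_*\big)\|x-y\|$, with a finite supremum. Put $\Delta_0=f(x_0)-f^*$. **Method (Ringmaster LMO) and computation model.** There are $n\ge1$ workers. Worker $i$ needs $\tau_i>0$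 seconds per stochastic gradient, $\tau_1\le\dots\le\tau_n$, and communication takes no time. At time $0$ all workers start computing stochastic gradients at $x_0$, and the server sets $k=0$. Whenever a worker $i$ finishes a gradient $g=\nabla f(x_{k-\delta};\xi)$, computed at the iterate $x_{k-\delta}$ it received last, the server does the following: if $\delta<R_k$, it sets $m_{k+1}=(1-\alpha_0)m_0+\alpha_{\mathrm{init}}g$ (if $k=0$) or $m_{k+1}=(1-\alpha_k)m_k+\alpha_kg$ (if $k\ge1$), then $x_{k+1}=x_k+\eta_k\,\mathrm{lmo}(m_{k+1})$, and increases $k$ by one; otherwise it discards $g$. In both cases worker $i$ immediately starts a new computation at the current iterate. All computations use independent samples $\xi\sim\mathcal D$; gradients finished at the same time may arrive in any fixed order that does not depend on the samples. **Parameters.** $\alpha_{\mathrm{init}}=\alpha_0=1$, $\alpha_k=k^{-1/2}$ for $k\ge1$, $R_k=1/\alpha_k$, and one of the following: - $L_1=0$, $\eta_k=\dfrac{\eta}{(k+1)^{3/4}}$ with any $\eta>0$, and $\Psi=\dfrac{\Delta_0}{\eta}+\rho\sigma+L_0\eta$; - $L_1>0$, $\eta_k=\dfrac{\eta}{17(k+1)^{3/4}}$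 with any $\eta>0$, and $\Psi=e^{L_1^2\eta^2}\dfrac{\Delta_0}{\eta}+\rho\sigma+e^{L_1^2\eta^2}L_0\eta$; - $L_1>0$ (known), $\eta_k=\dfrac{1}{17L_1(k+1)^{3/4}}$, and $\Psi=L_1\Delta_0+\rho\sigma+\dfrac{L_0}{L_1}$. **Theorem.** There is a universal constant $C>0$ such that, in this setting, the following holds for every $\varepsilon>0$. An $\varepsilon$-stationary point is reached: there is a least number of updates $K_\varepsilon$ with $\mathbb E\|\nabla f(x_{K_\varepsilon})\|_*\le\varepsilon$, and these $K_\varepsilon$ updates are completed in finite time. The time $T_\varepsilon$ at which update number $K_\varepsilon$ is completed satisfies $$T_\varepsilon\le C\min_{1\le m\le n}H_m\left(\frac{\Psi^2}{\varepsilon^2}\,\ell^2+\frac{\Psi^4}{m\,\varepsilon^4}\,\ell^4\right),\qquad \ell=1+\log\left(1+\frac{\Psi}{\varepsilon}\right),\qquad H_m=\Big(\frac1m\sum_{i=1}^m\frac1{\tau_i}\Big)^{-1},$$ that is, $T_\varepsilon=\widetilde{\mathcal O}\Big(\min_{1\le m\le n} H_m\big(\tfrac{\Psi^2}{\varepsilon^2}+\tfrac{\Psi^4}{m\varepsilon^4}\big)\Big)$.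 -/

import Mathlib

open MeasureTheory ProbabilityTheory

noncomputable section

/-- The parameter space `ℝ^d`, with its standard inner product and Euclidean norm. -/
abbrev Vec (d : ℕ) : Type := EuclideanSpace ℝ (Fin d)

/-! ### Norm, dual norm, linear minimization oracle -/

/-- The seminorm `N` on `ℝ^d` is a norm. -/
def IsNormOn {d : ℕ} (N : Seminorm ℝ (Vec d)) : Prop := ∀ x, N x = 0 → x = 0

/-- The dual norm `‖y‖_* = sup {⟨y, u⟩ : ‖u‖ ≤ 1}`. -/
def dualNorm {d : ℕ} (N : Seminorm ℝ (Vec d)) (y : Vec d) : ℝ :=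
  sSup ((fun u : Vec d => inner ℝ y u) '' {u | N u ≤ 1})

/-- The norm-equivalence constant `ρ = sup_{z ≠ 0} ‖z‖_* / ‖z‖₂`. -/
def normEquivConst {d : ℕ} (N : Seminorm ℝ (Vec d)) : ℝ :=
  ⨆ z : {z : Vec d // z ≠ 0}, dualNorm N z.1 / ‖z.1‖

/-- `lmo` selects a minimizer of `⟨y, u⟩` over the unit ball of `N` for every `y ≠ 0`, and
`lmo 0 = 0`. Any selection is allowed, as long as it is measurable (so that the iterates are
random variables). -/
structure IsLMO {d : ℕ} (N : Seminorm ℝ (Vec d)) (lmo : Vec d → Vec d) : Prop where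
  measurable : Measurable lmo
  map_zero : lmo 0 = 0
  mem_ball : ∀ y, y ≠ 0 → N (lmo y) ≤ 1
  isMin : ∀ y, y ≠ 0 → ∀ u, N u ≤ 1 → inner ℝ y (lmo y) ≤ inner ℝ y u

/-! ### Objective and assumptions -/

/-- The objective `f(x) = 𝔼_{ξ ∼ 𝒟} F(x; ξ)`. -/
def objective {d : ℕ} {Ξ : Type*} [MeasurableSpace Ξ] (𝒟 : Measure Ξ) (F : Vec d → Ξ → ℝ)
    (x : Vec d) : ℝ := ∫ s, F x s ∂𝒟

/-- The stochastic gradient `∇F(x; s)`, the gradient in the first argument. -/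
def stochGrad {d : ℕ} {Ξ : Type*} (F : Vec d → Ξ → ℝ) (x : Vec d) (s : Ξ) : Vec d :=
  gradient (fun y => F y s) x

/-- The objective is a well-defined differentiable function, every `F(·; s)` is differentiable,
and the stochastic gradients are unbiased with variance at most `σ²` in the Euclidean norm. -/
structure UnbiasedBoundedVariance {d : ℕ} {Ξ : Type*} [MeasurableSpace Ξ] (𝒟 : Measure Ξ)
    (F : Vec d → Ξ → ℝ) (σ : ℝ) : Prop where
  measurable_loss : ∀ x, Measurable (F x)
  integrable_loss : ∀ x, Integrable (F x) 𝒟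
  differentiable_objective : Differentiable ℝ (objective 𝒟 F)
  differentiable_loss : ∀ s, Differentiable ℝ (fun x => F x s)
  integrable_grad : ∀ x, Integrable (fun s => stochGrad F x s) 𝒟
  unbiased : ∀ x, ∫ s, stochGrad F x s ∂𝒟 = gradient (objective 𝒟 F) x
  integrable_sq : ∀ x, Integrable
    (fun s => ‖stochGrad F x s - gradient (objective 𝒟 F) x‖ ^ 2) 𝒟
  sigma_nonneg : 0 ≤ σ
  variance_le : ∀ x, ∫ s, ‖stochGrad F x s - gradient (objective 𝒟 F) x‖ ^ 2 ∂𝒟 ≤ σ ^ 2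

/-- `(L₀, L₁)`-smoothness of `f` with respect to `N`:
`‖∇f(x) - ∇f(y)‖_* ≤ sup_{θ ∈ [0,1]} (L₀ + L₁ ‖∇f(θ x + (1 - θ) y)‖_*) ‖x - y‖`,
the supremum being finite. -/
structure GenSmooth {d : ℕ} (N : Seminorm ℝ (Vec d)) (f : Vec d → ℝ) (L₀ L₁ : ℝ) : Prop where
  L₀_nonneg : 0 ≤ L₀
  L₁_nonneg : 0 ≤ L₁
  bddAbove : ∀ x y : Vec d, BddAbove ((fun θ : ℝ =>
    L₀ + L₁ * dualNorm N (gradient f (θ • x + (1 - θ) • y))) '' Set.Icc 0 1)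
  le_sup : ∀ x y : Vec d, dualNorm N (gradient f x - gradient f y) ≤
    sSup ((fun θ : ℝ =>
      L₀ + L₁ * dualNorm N (gradient f (θ • x + (1 - θ) • y))) '' Set.Icc 0 1) * N (x - y)

/-! ### Fixed computation model: who computes what, and when -/

/-- The (deterministic) state of the distributed system: the number `updates` of model updates
performed so far, the index `startIdx i` of the iterate at which worker `i` is currently computing
a stochastic gradient, the time `finish i` at which that computation will be completed, and the
current time. -/
structure SysState (n : ℕ) where
  updates : ℕ
  startIdx : Fin n → ℕ
  finish : Fin n → ℝ
  clock : ℝ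

/-- The delay of the gradient currently being computed by worker `i`. -/
def SysState.delay {n : ℕ} (s : SysState n) (i : Fin n) : ℝ :=
  (s.updates : ℝ) - (s.startIdx i : ℝ)

/-- At time `0` every worker `i` starts computing a gradient at the iterate of index `0`. -/
def sysInit {n : ℕ} (τ : Fin n → ℝ) : SysState n where
  updates := 0
  startIdx := fun _ => 0
  finish := τ
  clock := 0

/-- The number of updates after the arrival of the gradient of worker `i`: the gradient is
accepted if and only if its delay is smaller than the current threshold. -/
def SysState.nextUpdates {n : ℕ} (R : ℕ → ℝ) (s : SysState n) (i : Fin n) : ℕ :=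
  if s.delay i < R s.updates then s.updates + 1 else s.updates

/-- The gradient of worker `i` arrives. Whether or not it is accepted, worker `i` immediately
receives the current iterate and starts a new computation, which takes `τ i` seconds. -/
def SysState.step {n : ℕ} (τ : Fin n → ℝ) (R : ℕ → ℝ) (s : SysState n) (i : Fin n) :
    SysState n where
  updates := s.nextUpdates R i
  startIdx := Function.update s.startIdx i (s.nextUpdates R i)
  finish := Function.update s.finish i (s.finish i + τ i)
  clock := s.finish i

/-- The state of the system after `e` arrivals, when `w e` is the worker of arrival number `e`. -/
def sysRun {n : ℕ} (τ : Fin n → ℝ) (R : ℕ → ℝ) (w : ℕ → Fin n) : ℕ → SysState n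
  | 0 => sysInit τ
  | e + 1 => (sysRun τ R w e).step τ R (w e)

/-- `w` is an order of arrivals of the fixed computation model with computation times `τ`: the next
gradient to arrive is always one whose computation is completed first. Gradients that are completed
at the same time may arrive in any order. -/
def IsArrivalOrder {n : ℕ} (τ : Fin n → ℝ) (R : ℕ → ℝ) (w : ℕ → Fin n) : Prop :=
  ∀ e i, (sysRun τ R w e).finish (w e) ≤ (sysRun τ R w e).finish i

/-- `T` is the time needed to complete the first `K` updates, i.e. the time at which the number of
updates becomes `K`. -/
def IsCompletionTime {n : ℕ} (τ : Fin n → ℝ) (R : ℕ → ℝ) (w : ℕ → Fin n) (K : ℕ) (T : ℝ) : Prop :=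
  ∃ e, IsLeast {e | (sysRun τ R w e).updates = K} e ∧ T = (sysRun τ R w e).clock

/-- The harmonic mean of the computation times of the workers up to and including `m`
(with `Fin n` counting from `0`, these are `m + 1` workers). -/
def harmonicMean {n : ℕ} (τ : Fin n → ℝ) (m : Fin n) : ℝ :=
  ((1 / ((m : ℕ) + 1 : ℝ)) * ∑ i ∈ Finset.Iic m, 1 / τ i)⁻¹

/-! ### The iterates of Ringmaster LMO -/

/-- The current iterate, the current momentum, and the iterate `held i` at which worker `i` is
currently computing a stochastic gradient. -/
structure OptState (d n : ℕ) where
  x : Vec d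
  m : Vec d
  held : Fin n → Vec d

/-- Algorithmic parameters: stepsizes `η`, thresholds `R`, momentum parameters `α`, `αinit`. -/
structure AlgParams where
  η : ℕ → ℝ
  R : ℕ → ℝ
  α : ℕ → ℝ
  αinit : ℝ

/-- The new momentum, when the gradient `g` is accepted at iteration `k`. -/
def AlgParams.momentum {d : ℕ} (p : AlgParams) (k : ℕ) (m g : Vec d) : Vec d :=
  if k = 0 then (1 - p.α 0) • m + p.αinit • g else (1 - p.α k) • m + p.α k • g

/-- The effect of the arrival of the gradient of worker `i`, when the system is in state `s`;
`ζ i k` is the data sample which worker `i` uses at the iterate of index `k`. -/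
def OptState.step {d n : ℕ} {Ξ : Type*} (p : AlgParams) (lmo : Vec d → Vec d)
    (F : Vec d → Ξ → ℝ) (ζ : Fin n → ℕ → Ξ) (s : SysState n) (i : Fin n) (v : OptState d n) :
    OptState d n :=
  if s.delay i < p.R s.updates then
    let g := stochGrad F (v.held i) (ζ i (s.startIdx i))
    let m' := p.momentum s.updates v.m g
    let x' := v.x + p.η s.updates • lmo m'
    { x := x', m := m', held := Function.update v.held i x' }
  else
    { v with held := Function.update v.held i v.x }

/-- Iterate, momentum and worker iterates after `e` arrivals. -/
def optRun {d n : ℕ} {Ξ : Type*} (p : AlgParams) (lmo : Vec d → Vec d) (F : Vec d → Ξ → ℝ)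
    (x₀ m₀ : Vec d) (τ : Fin n → ℝ) (w : ℕ → Fin n) (ζ : Fin n → ℕ → Ξ) : ℕ → OptState d n
  | 0 => { x := x₀, m := m₀, held := fun _ => x₀ }
  | e + 1 => (optRun p lmo F x₀ m₀ τ w ζ e).step p lmo F ζ (sysRun τ p.R w e) (w e)

/-- The random samples `ξ i k` (worker `i`, iterate of index `k`) are i.i.d. with law `𝒟`. -/
structure IsIIDSampling {n : ℕ} {Ξ Ω : Type*} [MeasurableSpace Ξ] [MeasurableSpace Ω]
    (𝒟 : Measure Ξ) (P : Measure Ω) (ξ : Fin n → ℕ → Ω → Ξ) : Prop where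
  measurable : ∀ i k, Measurable (ξ i k)
  law : ∀ i k, P.map (ξ i k) = 𝒟
  indep : iIndepFun (fun q : Fin n × ℕ => ξ q.1 q.2) P

/-- The random point `X` is `ε`-stationary for `f`: `𝔼 ‖∇f(X)‖_* ≤ ε`. -/
def IsEpsStationary {d : ℕ} {Ω : Type*} [MeasurableSpace Ω] (N : Seminorm ℝ (Vec d))
    (f : Vec d → ℝ) (P : Measure Ω) (ε : ℝ) (X : Ω → Vec d) : Prop :=
  Integrable (fun ω => dualNorm N (gradient f (X ω))) P ∧
    ∫ ω, dualNorm N (gradient f (X ω)) ∂P ≤ ε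

/-- `K` is the number of iterations needed to reach an `ε`-stationary point: the least `k` such
that the iterate obtained after `k` updates is `ε`-stationary. -/
def IsIterationComplexity {d n : ℕ} {Ξ Ω : Type*} [MeasurableSpace Ξ] [MeasurableSpace Ω]
    (N : Seminorm ℝ (Vec d)) (𝒟 : Measure Ξ) (P : Measure Ω) (p : AlgParams)
    (lmo : Vec d → Vec d) (F : Vec d → Ξ → ℝ) (x₀ m₀ : Vec d) (τ : Fin n → ℝ)
    (w : ℕ → Fin n) (ξ : Fin n → ℕ → Ω → Ξ) (ε : ℝ) (K : ℕ) : Prop :=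
  IsLeast {k | ∃ e, (sysRun τ p.R w e).updates = k ∧
    IsEpsStationary N (objective 𝒟 F) P ε
      (fun ω => (optRun p lmo F x₀ m₀ τ w (fun i k => ξ i k ω) e).x)} K

/-! ### The parameter-agnostic schedule -/

/-- The momentum schedule `α₀ = 1`, `α_k = k^{-1/2}` for `k ≥ 1`. -/
def agnosticMomentum (k : ℕ) : ℝ := if k = 0 then 1 else (k : ℝ) ^ (-(1 / 2) : ℝ)

/-- Momentum `α_k`, `αinit = 1`, thresholds `R_k = 1 / α_k`, and stepsizes
`η_k = c / (k + 1)^{3/4}`. -/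
def agnosticParams (c : ℝ) : AlgParams where
  η := fun k => c / ((k : ℝ) + 1) ^ (3 / 4 : ℝ)
  R := fun k => 1 / agnosticMomentum k
  α := agnosticMomentum
  αinit := 1

/-- The envelope `e^{L₁²η²} Δ₀ / η + ρσ + e^{L₁²η²} L₀ η`. -/
def envelope (L₀ L₁ Δ₀ ρσ η : ℝ) : ℝ :=
  Real.exp (L₁ ^ 2 * η ^ 2) * (Δ₀ / η) + ρσ + Real.exp (L₁ ^ 2 * η ^ 2) * L₀ * η

/-- The three admissible choices of the stepsize constant `c` with the corresponding quantity `Ψ`: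
`L₁ = 0`; `L₁ > 0` (unknown); `L₁ > 0` known. -/
def AgnosticChoice (L₀ L₁ Δ₀ ρσ c Ψ : ℝ) : Prop :=
  (L₁ = 0 ∧ ∃ η : ℝ, 0 < η ∧ c = η ∧ Ψ = envelope L₀ 0 Δ₀ ρσ η) ∨
  (0 < L₁ ∧ ∃ η : ℝ, 0 < η ∧ c = η / 17 ∧ Ψ = envelope L₀ L₁ Δ₀ ρσ η) ∨
  (0 < L₁ ∧ c = 1 / (17 * L₁) ∧ Ψ = L₁ * Δ₀ + ρσ + L₀ / L₁)

end

/-! ### Dual norms -/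

section DualNorm

variable {d : ℕ} {N : Seminorm ℝ (Vec d)}

/-! The arrival process never looks at the samples: `τ`, `R` and `w` alone decide which gradients
are accepted, in which order and with what delay. The method is therefore a recursion with nonrandom
indices, in which update `k` uses a sample of its own at the iterate of index `s k`, with `k - s k <
R k` (`exists_update_recursion`). It remains to bound the number of updates before stationarity and
the time that a given number of updates takes.

Time. A gradient is discarded only if its delay is at least `√k`; the worker then restarts at index
`k`, and the square root of its start index has grown by at least `1/2`. After `k` updates each
worker has thus lost at most `2√k` gradients. Counting the arrivals of the first `m` workers only
gives time at most `H_m (k/m + 1 + 2√k)` (`sysRun_clock_le`).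

Updates. Write `q k` for `fourthRoot k`, `a` for the stepsize constant and `A = L₁ a`, so that the
stepsize is `a / q k ^ 3` and the momentum weight at `k + 1` is `1 / q k ^ 2`. An LMO step decreases
`f` by stepsize times gradient norm, up to twice the momentum error. That error splits into averaged
noise and drift. The noise is a sum of orthogonal terms, hence of size `ρσ / q k` in mean
(`integral_dualNorm_averagedNoise_le`). The drift is small because a delay below `q k ^ 2` is
weighted by `1 / q k ^ 2`, so a stale gradient costs about as much as one step
(`momentumDrift_succ_le`). Summed along the trajectory, the smoothness errors are at most half of
the gradient terms plus a multiple of the harmonic sum `∑ 1 / q k ^ 4`. No smallness of `A` is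
needed: once `q k ≥ 36 A` this is automatic, and before that the iterates are still so close to `x
0` that Grönwall bounds the gradient, which is where the factor exponential in `A ^ 2` arises
(`absorb`).

Since `∑_{k ≤ K} 1 / q k ^ 3 ≥ q K`, having no stationary iterate up to `K` forces `q K ≤ C (Ψ/ε) (1
+ 4 log (q K))`. Inverting this bounds `q K`, and the time bound at `q K ^ 4` updates gives the
claim. -/

lemma seminorm_continuous (N : Seminorm ℝ (Vec d)) : Continuous N :=
  (ConvexOn.locallyLipschitz N.convexOn).continuous

/-- A norm is continuous and positive on the compact Euclidean sphere, so it has a positive minimum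
there. The sphere is empty only for `d = 0`, where every constant works. -/
lemma IsNormOn.exists_norm_le (hN : IsNormOn N) : ∃ c : ℝ, 0 < c ∧ ∀ x, ‖x‖ ≤ c * N x := by
  rcases (Metric.sphere (0 : Vec d) 1).eq_empty_or_nonempty with h | h
  · refine ⟨1, one_pos, fun x => ?_⟩
    have hx : x = 0 := by
      by_contra hx
      have : (‖x‖⁻¹ • x) ∈ Metric.sphere (0 : Vec d) 1 := by
        simp [norm_smul, norm_ne_zero_iff.2 hx]
      simp [h] at this
    simp [hx]
  · obtain ⟨z, hz, hmin⟩ := (isCompact_sphere (0 : Vec d) 1).exists_isMinOn h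
      (seminorm_continuous N).continuousOn
    have hz1 : ‖z‖ = 1 := by simpa using hz
    have hpos : 0 < N z := by
      refine lt_of_le_of_ne (apply_nonneg N z) fun h0 => ?_
      have := hN z h0.symm
      simp [this] at hz1
    refine ⟨(N z)⁻¹, inv_pos.2 hpos, fun x => ?_⟩
    rcases eq_or_ne x 0 with rfl | hx
    · simp
    have hxn : 0 < ‖x‖ := norm_pos_iff.2 hx
    have hmem : (‖x‖⁻¹ • x) ∈ Metric.sphere (0 : Vec d) 1 := by
      simp [norm_smul, norm_ne_zero_iff.2 hx]
    have h1 : N z ≤ N (‖x‖⁻¹ • x) := hmin hmem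
    rw [map_smul_eq_mul, norm_inv, norm_norm] at h1
    rw [inv_mul_eq_div, le_div_iff₀ hpos]
    calc ‖x‖ * N z ≤ ‖x‖ * (‖x‖⁻¹ * N x) := by gcongr
      _ = N x := by field_simp

lemma dualNorm_bddAbove (hN : IsNormOn N) (y : Vec d) :
    BddAbove ((fun u : Vec d => (inner ℝ y u : ℝ)) '' {u | N u ≤ 1}) := by
  obtain ⟨c, hc, h⟩ := hN.exists_norm_le
  refine ⟨‖y‖ * c, ?_⟩
  rintro _ ⟨u, hu, rfl⟩
  have hu' : N u ≤ 1 := hu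
  calc (inner ℝ y u : ℝ) ≤ ‖y‖ * ‖u‖ := real_inner_le_norm y u
    _ ≤ ‖y‖ * (c * N u) := by gcongr; exact h u
    _ ≤ ‖y‖ * (c * 1) := by gcongr
    _ = ‖y‖ * c := by ring

lemma dualNorm_le {y : Vec d} {b : ℝ} (h : ∀ u, N u ≤ 1 → (inner ℝ y u : ℝ) ≤ b) :
    dualNorm N y ≤ b := by
  refine csSup_le ⟨_, 0, by simp, rfl⟩ ?_
  rintro _ ⟨u, hu, rfl⟩
  exact h u hu

lemma inner_le_dualNorm_of_le_one (hN : IsNormOn N) (y : Vec d) {u : Vec d} (hu : N u ≤ 1) :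
    (inner ℝ y u : ℝ) ≤ dualNorm N y :=
  le_csSup (dualNorm_bddAbove hN y) ⟨u, hu, rfl⟩

lemma dualNorm_nonneg (hN : IsNormOn N) (y : Vec d) : 0 ≤ dualNorm N y := by
  simpa using inner_le_dualNorm_of_le_one hN y (u := 0) (by simp)

lemma inner_le_dualNorm_mul (hN : IsNormOn N) (y u : Vec d) :
    (inner ℝ y u : ℝ) ≤ dualNorm N y * N u := by
  rcases eq_or_ne u 0 with rfl | hu
  · simp
  have hpos : 0 < N u := lt_of_le_of_ne (apply_nonneg N u) fun h => hu (hN u h.symm)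
  have := inner_le_dualNorm_of_le_one hN y (u := (N u)⁻¹ • u)
    (by rw [map_smul_eq_mul, norm_inv, Real.norm_of_nonneg hpos.le]; field_simp; rfl)
  rw [inner_smul_right, inv_mul_eq_div, div_le_iff₀ hpos] at this
  exact this

lemma dualNorm_zero : dualNorm N (0 : Vec d) = 0 := by
  have : ((fun u : Vec d => (inner ℝ (0 : Vec d) u : ℝ)) '' {u | N u ≤ 1}) = {0} := by
    ext r
    simp only [inner_zero_left, Set.mem_image, Set.mem_ofPred_eq, Set.mem_singleton_iff]
    exact ⟨fun ⟨_, _, h⟩ => h.symm, fun h => ⟨0, by simp, h.symm⟩⟩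
  rw [dualNorm, this, csSup_singleton]

lemma dualNorm_add_le (hN : IsNormOn N) (y z : Vec d) :
    dualNorm N (y + z) ≤ dualNorm N y + dualNorm N z := by
  refine dualNorm_le fun u hu => ?_
  rw [inner_add_left]
  exact add_le_add (inner_le_dualNorm_of_le_one hN y hu) (inner_le_dualNorm_of_le_one hN z hu)

lemma dualNorm_smul_le (hN : IsNormOn N) {r : ℝ} (hr : 0 ≤ r) (y : Vec d) :
    dualNorm N (r • y) ≤ r * dualNorm N y := by
  refine dualNorm_le fun u hu => ?_
  rw [real_inner_smul_left]
  exact mul_le_mul_of_nonneg_left (inner_le_dualNorm_of_le_one hN y hu) hr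

lemma dualNorm_neg (hN : IsNormOn N) (y : Vec d) : dualNorm N (-y) = dualNorm N y := by
  have key : ∀ z : Vec d, dualNorm N (-z) ≤ dualNorm N z := fun z => dualNorm_le fun u hu => by
    rw [inner_neg_left, ← inner_neg_right]
    exact inner_le_dualNorm_of_le_one hN z (by simpa using hu)
  exact le_antisymm (key y) (by simpa using key (-y))

lemma dualNorm_sub_comm (hN : IsNormOn N) (y z : Vec d) :
    dualNorm N (y - z) = dualNorm N (z - y) := by
  rw [← dualNorm_neg hN, neg_sub]

lemma dualNorm_le_add_sub (hN : IsNormOn N) (y z : Vec d) :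
    dualNorm N y ≤ dualNorm N z + dualNorm N (y - z) := by
  simpa using dualNorm_add_le hN z (y - z)

lemma exists_dualNorm_le_mul_norm (hN : IsNormOn N) :
    ∃ c : ℝ, 0 < c ∧ ∀ y, dualNorm N y ≤ c * ‖y‖ := by
  obtain ⟨c, hc, h⟩ := hN.exists_norm_le
  refine ⟨c, hc, fun y => dualNorm_le fun u hu => ?_⟩
  calc (inner ℝ y u : ℝ) ≤ ‖y‖ * ‖u‖ := real_inner_le_norm y u
    _ ≤ ‖y‖ * (c * N u) := by gcongr; exact h u
    _ ≤ ‖y‖ * (c * 1) := by gcongr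
    _ = c * ‖y‖ := by ring

lemma dualNorm_le_normEquivConst_mul (hN : IsNormOn N) (y : Vec d) :
    dualNorm N y ≤ normEquivConst N * ‖y‖ := by
  rcases eq_or_ne y 0 with rfl | hy
  · simp [dualNorm_zero]
  obtain ⟨c, hc, h⟩ := exists_dualNorm_le_mul_norm hN
  have hb : BddAbove (Set.range fun z : {z : Vec d // z ≠ 0} => dualNorm N z.1 / ‖z.1‖) := by
    refine ⟨c, ?_⟩
    rintro _ ⟨z, rfl⟩
    exact (div_le_iff₀ (norm_pos_iff.2 z.2)).2 (h z.1)
  have := le_ciSup hb ⟨y, hy⟩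
  exact (div_le_iff₀ (norm_pos_iff.2 hy)).1 this

lemma normEquivConst_nonneg (hN : IsNormOn N) : 0 ≤ normEquivConst N :=
  Real.iSup_nonneg fun z => div_nonneg (dualNorm_nonneg hN z.1) (norm_nonneg _)

lemma dualNorm_continuous (hN : IsNormOn N) : Continuous (dualNorm N) := by
  obtain ⟨c, hc, h⟩ := exists_dualNorm_le_mul_norm hN
  refine (LipschitzWith.of_le_add_mul c.toNNReal fun x y => ?_).continuous
  calc dualNorm N x ≤ dualNorm N y + dualNorm N (x - y) := dualNorm_le_add_sub hN x y
    _ ≤ dualNorm N y + c * ‖x - y‖ := by gcongr; exact h _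
    _ = _ := by rw [dist_eq_norm, Real.coe_toNNReal _ hc.le]

lemma IsLMO.seminorm_le_one {lmo : Vec d → Vec d} (h : IsLMO N lmo) (y : Vec d) :
    N (lmo y) ≤ 1 := by
  rcases eq_or_ne y 0 with rfl | hy
  · simp [h.map_zero]
  · exact h.mem_ball y hy

lemma IsLMO.inner_le {lmo : Vec d → Vec d} (h : IsLMO N lmo) (y : Vec d) :
    (inner ℝ y (lmo y) : ℝ) ≤ -dualNorm N y := by
  rcases eq_or_ne y 0 with rfl | hy
  · simp [dualNorm_zero]
  · rw [le_neg]
    refine dualNorm_le fun u hu => ?_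
    have := h.isMin y hy (-u) (by simpa using hu)
    rw [inner_neg_right] at this
    linarith

end DualNorm

/-! ### Generalized smoothness -/

section GenSmooth

variable {d : ℕ} {N : Seminorm ℝ (Vec d)} {f : Vec d → ℝ} {L₀ L₁ : ℝ}

/-- The factor `φ` is `(e^K - 1) / K`, or `1` at `K = 0`. Keeping both `φ ≤ e^K` and the exact
relation `1 + K φ = e^K` lets the bound on a gradient difference and the bound on a gradient norm
come from one estimate. -/
lemma gronwallBound_zero_one (K : ℝ) (hK : 0 ≤ K) :
    ∃ φ : ℝ, 0 ≤ φ ∧ φ ≤ Real.exp K ∧ 1 + K * φ = Real.exp K ∧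
      ∀ ε, gronwallBound 0 K ε 1 = ε * φ := by
  rcases eq_or_ne K 0 with rfl | hK0
  · exact ⟨1, by simp, by simp, by simp, fun ε => by simp [gronwallBound_K0]⟩
  have hpos : 0 < K := lt_of_le_of_ne hK hK0.symm
  refine ⟨(Real.exp K - 1) / K, ?_, ?_, by field_simp; ring, fun ε => ?_⟩
  · have := Real.add_one_le_exp K
    exact div_nonneg (by linarith) hK
  · rw [div_le_iff₀ hpos]
    have h1 := Real.add_one_le_exp (-K)
    have h2 : Real.exp K * Real.exp (-K) = 1 := by rw [← Real.exp_add]; simp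
    nlinarith [Real.exp_pos K]
  · rw [gronwallBound_of_K_ne_0 hK0]
    simp
    ring

/-- Grönwall's inequality for the gradient along a segment. -/
lemma GenSmooth.dualNorm_gradient_sub_le_gronwallBound (hN : IsNormOn N)
    (hf : GenSmooth N f L₀ L₁) (x y : Vec d) :
    dualNorm N (gradient f x - gradient f y) ≤
      gronwallBound 0 (L₁ * N (x - y)) ((L₀ + L₁ * dualNorm N (gradient f y)) * N (x - y)) 1 := by
  have hL1 := hf.L₁_nonneg
  set z : ℝ → Vec d := fun t => t • x + (1 - t) • y with hz
  set X := N (x - y) with hX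
  have hX0 : 0 ≤ X := apply_nonneg N _
  set H : ℝ → ℝ := fun t => L₀ + L₁ * dualNorm N (gradient f (z t)) with hH
  set M := sSup (H '' Set.Icc 0 1) with hM
  have hHM : ∀ t ∈ Set.Icc (0 : ℝ) 1, H t ≤ M := fun t ht =>
    le_csSup (hf.bddAbove x y) ⟨t, ht, rfl⟩
  have hM0 : 0 ≤ M := le_trans (add_nonneg hf.L₀_nonneg (mul_nonneg hL1 (dualNorm_nonneg hN _)))
    (hHM 0 (by simp))
  have hseg : ∀ s t θ : ℝ, θ • z t + (1 - θ) • z s = z (θ * t + (1 - θ) * s) := by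
    intro s t θ
    simp only [hz]
    module
  have hNz : ∀ s t : ℝ, s ≤ t → N (z t - z s) = (t - s) * X := by
    intro s t hst
    have : z t - z s = (t - s) • (x - y) := by simp only [hz]; module
    rw [this, map_smul_eq_mul, Real.norm_of_nonneg (by linarith)]
  -- A subsegment of the segment is again a segment, so the supremum in the smoothness condition may
  -- be taken over `[s, t]` only. This localization is what turns the condition into a differential
  -- inequality.
  have hstep : ∀ s ∈ Set.Icc (0 : ℝ) 1, ∀ t ∈ Set.Icc (0 : ℝ) 1, s ≤ t → ∀ B,
      (∀ u ∈ Set.Icc s t, H u ≤ B) →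
      dualNorm N (gradient f (z t) - gradient f (z s)) ≤ B * ((t - s) * X) := by
    intro s hs t ht hst B hB
    refine (hf.le_sup (z t) (z s)).trans ?_
    rw [hNz s t hst]
    refine mul_le_mul_of_nonneg_right ?_ (mul_nonneg (by linarith) hX0)
    refine csSup_le ⟨_, 0, by simp, rfl⟩ ?_
    rintro _ ⟨θ, hθ, rfl⟩
    simp only [hseg]
    exact hB _ ⟨by nlinarith [hθ.1, hθ.2], by nlinarith [hθ.1, hθ.2]⟩
  have hlip : ∀ s ∈ Set.Icc (0 : ℝ) 1, ∀ t ∈ Set.Icc (0 : ℝ) 1, s ≤ t →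
      dualNorm N (gradient f (z t) - gradient f (z s)) ≤ M * ((t - s) * X) :=
    fun s hs t ht hst => hstep s hs t ht hst M fun u hu =>
      hHM u ⟨hs.1.trans hu.1, hu.2.trans ht.2⟩
  set h : ℝ → ℝ := fun t => dualNorm N (gradient f (z t) - gradient f (z 0)) with hh
  have hdiff : ∀ s t, h t - h s ≤ dualNorm N (gradient f (z t) - gradient f (z s)) := by
    intro s t
    have := dualNorm_le_add_sub hN (gradient f (z t) - gradient f (z 0))
      (gradient f (z s) - gradient f (z 0))
    rw [sub_sub_sub_cancel_right] at this
    simp only [hh]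
    linarith
  have hcont : ContinuousOn h (Set.Icc 0 1) := by
    refine (LipschitzOnWith.of_le_add_mul (K := (M * X).toNNReal) fun s hs t ht => ?_).continuousOn
    rw [Real.coe_toNNReal _ (mul_nonneg hM0 hX0), Real.dist_eq]
    rcases le_total s t with hst | hst
    · have h1 := hdiff t s
      rw [dualNorm_sub_comm hN] at h1
      have h2 := hlip s hs t ht hst
      rw [abs_of_nonpos (by linarith)]
      nlinarith
    · have h1 := hdiff t s
      have h2 := hlip t ht s hs hst
      rw [abs_of_nonneg (by linarith)]
      nlinarith
  have hgr := le_gronwallBound_of_liminf_deriv_right_le (f := h) (f' := fun t => H t * X) (δ := 0)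
    (K := L₁ * X) (ε := (L₀ + L₁ * dualNorm N (gradient f y)) * X) (a := 0) (b := 1) hcont
    (fun s hs r hr => ?_) (by simp [hh, dualNorm_zero]) (fun t _ => ?_) 1 (by simp)
  · simpa [hh, hz] using hgr
  -- The crude Lipschitz bound `M` shows that `H` exceeds `H s` on `[s, t]` by at most `L₁ M (t - s)
  -- X`. This vanishes as `t` decreases to `s`, so the upper right derivative of `h` at `s` is at
  -- most `H s * X`.
  · refine Filter.Eventually.frequently ?_
    have hlim : Filter.Tendsto (fun t => (H s + L₁ * (M * ((t - s) * X))) * X)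
        (nhdsWithin s (Set.Ioi s)) (nhds (H s * X)) := by
      have : Continuous fun t => (H s + L₁ * (M * ((t - s) * X))) * X := by fun_prop
      simpa using this.continuousAt.tendsto.mono_left (nhdsWithin_le_nhds (a := s) (s := Set.Ioi s))
    filter_upwards [hlim.eventually (gt_mem_nhds hr), Ioo_mem_nhdsGT hs.2] with t ht hst
    have hs' : s ∈ Set.Icc (0 : ℝ) 1 := ⟨hs.1, hs.2.le⟩
    have ht' : t ∈ Set.Icc (0 : ℝ) 1 := ⟨hs.1.trans hst.1.le, hst.2.le⟩
    have hts : 0 < t - s := sub_pos.2 hst.1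
    refine lt_of_le_of_lt ?_ ht
    rw [inv_mul_eq_div, div_le_iff₀ hts]
    refine (hdiff s t).trans ((hstep s hs' t ht' hst.1.le (H s + L₁ * (M * ((t - s) * X))) ?_).trans
      (le_of_eq (by ring)))
    intro u hu
    have hu' : u ∈ Set.Icc (0 : ℝ) 1 := ⟨hs.1.trans hu.1, hu.2.trans ht'.2⟩
    have h1 := dualNorm_le_add_sub hN (gradient f (z u)) (gradient f (z s))
    have h2 := hlip s hs' u hu' hu.1
    have h3 : M * ((u - s) * X) ≤ M * ((t - s) * X) := by
      gcongr
      exact hu.2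
    simp only [hH]
    nlinarith
  · have h1 := dualNorm_le_add_sub hN (gradient f (z t)) (gradient f (z 0))
    have h0 : z 0 = y := by simp [hz]
    rw [h0] at h1
    have h2 : L₁ * dualNorm N (gradient f (z t)) ≤
        L₁ * (dualNorm N (gradient f y) + dualNorm N (gradient f (z t) - gradient f y)) :=
      mul_le_mul_of_nonneg_left h1 hL1
    simp only [hH, hh, h0]
    nlinarith

lemma GenSmooth.dualNorm_gradient_sub_le (hN : IsNormOn N) (hf : GenSmooth N f L₀ L₁)
    (x y : Vec d) {X : ℝ} (hX : N (x - y) ≤ X) :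
    dualNorm N (gradient f x - gradient f y) ≤
      (L₀ + L₁ * dualNorm N (gradient f y)) * X * Real.exp (L₁ * X) := by
  have hL1 := hf.L₁_nonneg
  obtain ⟨φ, h0, h1, -, h3⟩ := gronwallBound_zero_one (L₁ * N (x - y))
    (mul_nonneg hL1 (apply_nonneg N _))
  have h := hf.dualNorm_gradient_sub_le_gronwallBound hN x y
  rw [h3] at h
  refine h.trans ?_
  have hG := dualNorm_nonneg hN (gradient f y)
  have hL0 := hf.L₀_nonneg
  have hX0 : 0 ≤ N (x - y) := apply_nonneg N _
  have : φ ≤ Real.exp (L₁ * X) := h1.trans (Real.exp_le_exp.2 (by gcongr))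
  have hX1 : 0 ≤ X := hX0.trans hX
  gcongr

lemma GenSmooth.dualNorm_gradient_le (hN : IsNormOn N) (hf : GenSmooth N f L₀ L₁)
    (x y : Vec d) {X : ℝ} (hX : N (x - y) ≤ X) :
    dualNorm N (gradient f x) ≤
      Real.exp (L₁ * X) * (dualNorm N (gradient f y) + L₀ * X) := by
  have hL1 := hf.L₁_nonneg
  have hX0 : 0 ≤ N (x - y) := apply_nonneg N _
  obtain ⟨φ, h0, h1, h2, h3⟩ := gronwallBound_zero_one (L₁ * N (x - y)) (mul_nonneg hL1 hX0)
  have h := hf.dualNorm_gradient_sub_le_gronwallBound hN x y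
  rw [h3] at h
  have hG := dualNorm_nonneg hN (gradient f y)
  have hL0 := hf.L₀_nonneg
  have h4 := dualNorm_le_add_sub hN (gradient f x) (gradient f y)
  have h5 : Real.exp (L₁ * N (x - y)) ≤ Real.exp (L₁ * X) := Real.exp_le_exp.2 (by gcongr)
  calc dualNorm N (gradient f x)
      ≤ dualNorm N (gradient f y) + (L₀ + L₁ * dualNorm N (gradient f y)) * N (x - y) * φ := by
        linarith
    _ = (1 + L₁ * N (x - y) * φ) * dualNorm N (gradient f y) + L₀ * N (x - y) * φ := by ring
    _ ≤ Real.exp (L₁ * X) * dualNorm N (gradient f y) + L₀ * X * Real.exp (L₁ * X) := by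
        rw [h2]
        have := h1.trans h5
        have hX1 : 0 ≤ X := hX0.trans hX
        gcongr
    _ = _ := by ring

/-- The mean value theorem along the segment replaces integration. It costs only the factor `1/2` in
the quadratic term and needs no continuity of the gradient. -/
lemma GenSmooth.descent (hN : IsNormOn N) (hf : GenSmooth N f L₀ L₁)
    (hdiff : Differentiable ℝ f) (x u : Vec d) {X : ℝ} (hX : N u ≤ X) :
    f (x + u) ≤ f x + inner ℝ (gradient f x) u +
      (L₀ + L₁ * dualNorm N (gradient f x)) * X ^ 2 * Real.exp (L₁ * X) := by
  have hline : ∀ t : ℝ, HasDerivAt (fun t : ℝ => f (x + t • u))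
      (inner ℝ (gradient f (x + t • u)) u) t := by
    intro t
    have h1 : HasDerivAt (fun t : ℝ => x + t • u) u t := by
      simpa using ((hasDerivAt_id t).smul_const u).const_add x
    have h2 := (hdiff (x + t • u)).hasGradientAt.hasFDerivAt.comp_hasDerivAt t h1
    simp only [InnerProductSpace.toDual_apply_apply] at h2
    exact h2
  obtain ⟨t, ht, hslope⟩ := exists_hasDerivAt_eq_slope (fun t : ℝ => f (x + t • u))
    (fun t => inner ℝ (gradient f (x + t • u)) u) (zero_lt_one)
    (fun t _ => (hline t).continuousAt.continuousWithinAt) (fun t _ => hline t)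
  simp only [one_smul, zero_smul, add_zero, sub_zero, div_one] at hslope
  have hu0 : 0 ≤ N u := apply_nonneg N u
  have hNt : N (x + t • u - x) ≤ X := by
    rw [add_sub_cancel_left, map_smul_eq_mul, Real.norm_of_nonneg ht.1.le]
    nlinarith [ht.2]
  have h1 := hf.dualNorm_gradient_sub_le hN (x + t • u) x hNt
  have h2 := inner_le_dualNorm_mul hN (gradient f (x + t • u) - gradient f x) u
  rw [inner_sub_left] at h2
  have h3 : dualNorm N (gradient f (x + t • u) - gradient f x) * N u ≤
      (L₀ + L₁ * dualNorm N (gradient f x)) * X * Real.exp (L₁ * X) * X :=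
    mul_le_mul h1 hX hu0 ((dualNorm_nonneg hN _).trans h1)
  nlinarith

/-- The gradient at a point is controlled by the optimality gap. -/
lemma GenSmooth.dualNorm_gradient_le_gap (hN : IsNormOn N) (hf : GenSmooth N f L₀ L₁)
    (hdiff : Differentiable ℝ f) {lmo : Vec d → Vec d} (hlmo : IsLMO N lmo) {fstar : ℝ}
    (hstar : ∀ x, fstar ≤ f x) (x : Vec d) {r : ℝ} (hr : 0 < r) (hLr : L₁ * r ≤ 1 / 4) :
    dualNorm N (gradient f x) ≤ 2 * (f x - fstar) / r + 4 * L₀ * r := by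
  -- The test point is one LMO step of length `r`. Its value is at least `fstar`, and `L₁ r ≤ 1/4`
  -- lets half of the linear decrease absorb the `L₁` part of the quadratic term.
  have hle : N (r • lmo (gradient f x)) ≤ r := by
    rw [map_smul_eq_mul, Real.norm_of_nonneg hr.le]
    nlinarith [hlmo.seminorm_le_one (gradient f x)]
  have h1 := hf.descent hN hdiff x (r • lmo (gradient f x)) hle
  rw [inner_smul_right] at h1
  have h2 := hlmo.inner_le (gradient f x)
  have h3 := hstar (x + r • lmo (gradient f x))
  have hL1 := hf.L₁_nonneg
  have hL0 := hf.L₀_nonneg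
  have hG := dualNorm_nonneg hN (gradient f x)
  have hexp : Real.exp (L₁ * r) ≤ 2 := by
    have h4 := Real.add_one_le_exp (-(L₁ * r))
    have h5 : Real.exp (L₁ * r) * Real.exp (-(L₁ * r)) = 1 := by rw [← Real.exp_add]; simp
    nlinarith [Real.exp_pos (L₁ * r)]
  have h6 : (L₀ + L₁ * dualNorm N (gradient f x)) * r ^ 2 * Real.exp (L₁ * r) ≤
      (L₀ + L₁ * dualNorm N (gradient f x)) * r ^ 2 * 2 := by gcongr
  have h7 : r * (inner ℝ (gradient f x) (lmo (gradient f x)) : ℝ) ≤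
      r * -dualNorm N (gradient f x) := by gcongr
  have h8 : L₁ * r * (r * dualNorm N (gradient f x)) ≤ 1 / 4 * (r * dualNorm N (gradient f x)) := by
    gcongr
  have h9 : r * dualNorm N (gradient f x) ≤ 2 * (f x - fstar) + 4 * L₀ * r * r := by nlinarith
  have : dualNorm N (gradient f x) = r * dualNorm N (gradient f x) / r := by field_simp
  rw [this]
  calc r * dualNorm N (gradient f x) / r ≤ (2 * (f x - fstar) + 4 * L₀ * r * r) / r := by gcongr
    _ = _ := by field_simp

end GenSmooth

/-! ### The computation model -/

section System

lemma agnosticParams_R (c : ℝ) (k : ℕ) :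
    (agnosticParams c).R k = if k = 0 then 1 else √(k : ℝ) := by
  simp only [agnosticParams, agnosticMomentum]
  split_ifs with h
  · simp
  · rw [Real.rpow_neg (Nat.cast_nonneg k), Real.sqrt_eq_rpow]
    simp

lemma sqrt_le_agnosticParams_R (c : ℝ) (k : ℕ) : √(k : ℝ) ≤ (agnosticParams c).R k := by
  rw [agnosticParams_R]
  split_ifs with h
  · simp [h]
  · rfl

lemma one_le_agnosticParams_R (c : ℝ) (k : ℕ) : 1 ≤ (agnosticParams c).R k := by
  rw [agnosticParams_R]
  split_ifs with h
  · rfl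
  · exact Real.one_le_sqrt.2 (by exact_mod_cast Nat.one_le_iff_ne_zero.2 h)

variable {n : ℕ} {τ : Fin n → ℝ} {R : ℕ → ℝ} {w : ℕ → Fin n}

lemma SysState.le_nextUpdates (s : SysState n) (i : Fin n) : s.updates ≤ s.nextUpdates R i := by
  unfold SysState.nextUpdates; split_ifs <;> omega

lemma SysState.nextUpdates_le (s : SysState n) (i : Fin n) :
    s.nextUpdates R i ≤ s.updates + 1 := by
  unfold SysState.nextUpdates; split_ifs <;> omega

lemma sysRun_updates_succ (e : ℕ) :
    (sysRun τ R w (e + 1)).updates = (sysRun τ R w e).nextUpdates R (w e) := rfl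

lemma sysRun_updates_mono : Monotone fun e => (sysRun τ R w e).updates :=
  monotone_nat_of_le_succ fun e => (sysRun τ R w e).le_nextUpdates (w e)

lemma sysRun_startIdx_succ (e : ℕ) (i : Fin n) :
    (sysRun τ R w (e + 1)).startIdx i =
      if i = w e then (sysRun τ R w (e + 1)).updates else (sysRun τ R w e).startIdx i := by
  simp only [sysRun, SysState.step, Function.update_apply]

lemma sysRun_startIdx_le (e : ℕ) (i : Fin n) :
    (sysRun τ R w e).startIdx i ≤ (sysRun τ R w e).updates := by
  induction e with
  | zero => simp [sysRun, sysInit]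
  | succ e ih =>
    rw [sysRun_startIdx_succ]
    split_ifs
    · rfl
    · exact ih.trans (sysRun_updates_mono e.le_succ)

lemma sysRun_startIdx_mono (i : Fin n) : Monotone fun e => (sysRun τ R w e).startIdx i := by
  refine monotone_nat_of_le_succ fun e => ?_
  rw [sysRun_startIdx_succ]
  split_ifs
  · exact (sysRun_startIdx_le e i).trans (sysRun_updates_mono e.le_succ)
  · rfl

/-- The start index of a worker strictly increases at each of its arrivals. -/
lemma sysRun_startIdx_lt (hR : ∀ k, 1 ≤ R k) (e : ℕ) :
    (sysRun τ R w e).startIdx (w e) < (sysRun τ R w (e + 1)).startIdx (w e) := by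
  rw [sysRun_startIdx_succ, if_pos rfl, sysRun_updates_succ]
  have h := sysRun_startIdx_le (τ := τ) (R := R) (w := w) e (w e)
  unfold SysState.nextUpdates
  split_ifs with hd
  · omega
  · rw [not_lt, SysState.delay] at hd
    have h1 := (hR _).trans hd
    have h2 : ((sysRun τ R w e).startIdx (w e) : ℝ) < (sysRun τ R w e).updates := by linarith
    exact_mod_cast h2

/-- Start indices of one worker strictly increase, even at a discard, since its delay is at least `R
≥ 1`. Hence no sample is used twice, and the samples consumed by the updates are independent. -/
lemma injective_arrival (hR : ∀ k, 1 ≤ R k) :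
    Function.Injective fun e => (w e, (sysRun τ R w e).startIdx (w e)) := by
  have key : ∀ e e', e < e' → (w e, (sysRun τ R w e).startIdx (w e)) ≠
      (w e', (sysRun τ R w e').startIdx (w e')) := by
    intro e e' hlt heq
    obtain ⟨h1, h2⟩ := Prod.ext_iff.1 heq
    simp only at h1 h2
    have h3 := sysRun_startIdx_lt (τ := τ) (w := w) hR e
    have h4 := sysRun_startIdx_mono (τ := τ) (R := R) (w := w) (w e) (Nat.succ_le_of_lt hlt)
    simp only [Nat.succ_eq_add_one] at h4
    rw [← h1] at h2
    omega
  intro e e' h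
  rcases lt_trichotomy e e' with hlt | rfl | hlt
  · exact absurd h (key _ _ hlt)
  · rfl
  · exact absurd h.symm (key _ _ hlt)

/-- `(√k - √s)(√k + √s) = k - s ≥ √k`, while `√k + √s ≤ 2 √k`. The case `k = 0` has to be set apart.
-/
lemma half_le_sqrt_sub_sqrt {s k : ℝ} (hs : 0 ≤ s) (hk : √k ≤ k - s) :
    1 / 2 ≤ √k - √s ∨ k = 0 := by
  rcases eq_or_ne k 0 with h | h
  · exact Or.inr h
  left
  have hk0 : 0 ≤ k := by nlinarith [Real.sqrt_nonneg k]
  have hkpos : 0 < √k := Real.sqrt_pos.2 (lt_of_le_of_ne hk0 h.symm)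
  have h1 := Real.sq_sqrt hk0
  have h2 := Real.sq_sqrt hs
  have h3 := Real.sqrt_nonneg s
  by_contra! hcon
  have h4 : (√k - √s) * (√k + √s) < 1 / 2 * (√k + √s) := by gcongr
  have h5 : √k < √s := by nlinarith
  nlinarith

/-- Every discarded gradient of a worker is paid for by the growth of the square root of its start
index. -/
lemma sum_arrivals_le_updates (hτ : ∀ i, 0 < τ i) (hR1 : ∀ k, 1 ≤ R k)
    (hR : ∀ k : ℕ, √(k : ℝ) ≤ R k) (S : Finset (Fin n)) (e : ℕ) :
    ∑ i ∈ S, ((sysRun τ R w e).finish i / τ i - 1 - 2 * √((sysRun τ R w e).startIdx i : ℝ)) ≤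
      (sysRun τ R w e).updates := by
  induction e with
  | zero =>
    have : ∀ i, τ i / τ i = 1 := fun i => div_self (hτ i).ne'
    simp [sysRun, sysInit, this]
  | succ e ih =>
    set s := sysRun τ R w e with hs
    set s' := sysRun τ R w (e + 1) with hs'
    -- `finish i / τ i - 1` is the number of arrivals of worker `i` so far. An accepted arrival
    -- raises this count and `updates` by one; a discarded one raises the count by one and `2
    -- √startIdx` by at least one.
    set g : SysState n → Fin n → ℝ :=
      fun s i => s.finish i / τ i - 1 - 2 * √(s.startIdx i : ℝ) with hg
    have hother : ∀ i, i ≠ w e → g s' i = g s i := by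
      intro i hi
      simp [hg, hs', sysRun, SysState.step, hi, hs]
    have hself : g s' (w e) ≤ g s (w e) + ((s'.updates : ℝ) - s.updates) := by
      have hfin : s'.finish (w e) / τ (w e) = s.finish (w e) / τ (w e) + 1 := by
        have := (hτ (w e)).ne'
        simp only [hs', sysRun, SysState.step, Function.update_self]
        rw [add_div, div_self this]
      have hst : s'.startIdx (w e) = s'.updates := by
        rw [hs', sysRun_startIdx_succ, if_pos rfl]
      have hle := sysRun_startIdx_le (τ := τ) (R := R) (w := w) e (w e)
      simp only [hg, hfin, hst]
      have hup : s'.updates = s.nextUpdates R (w e) := rfl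
      unfold SysState.nextUpdates at hup
      split_ifs at hup with hd
      · have h1 : √(s.startIdx (w e) : ℝ) ≤ √(s'.updates : ℝ) := by
          apply Real.sqrt_le_sqrt
          rw [hup]
          exact_mod_cast hle.trans (Nat.le_succ _)
        rw [hup] at h1 ⊢
        push_cast at h1 ⊢
        linarith
      · rw [not_lt, SysState.delay] at hd
        rw [hup]
        have h1 := (hR s.updates).trans hd
        rcases half_le_sqrt_sub_sqrt (Nat.cast_nonneg _) h1 with h2 | h2
        · linarith
        · have h3 := (hR1 s.updates).trans hd
          have h4 : (0 : ℝ) ≤ s.startIdx (w e) := Nat.cast_nonneg _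
          linarith
    have hup0 : (s.updates : ℝ) ≤ s'.updates := by
      exact_mod_cast sysRun_updates_mono (τ := τ) (R := R) (w := w) e.le_succ
    have hsum : ∑ i ∈ S, g s' i ≤ ∑ i ∈ S, g s i + ((s'.updates : ℝ) - s.updates) := by
      by_cases hmem : w e ∈ S
      · rw [← Finset.add_sum_erase S _ hmem, ← Finset.add_sum_erase S (g s) hmem,
          Finset.sum_congr rfl fun i hi => hother i (Finset.ne_of_mem_erase hi)]
        linarith
      · rw [Finset.sum_congr rfl fun i hi => hother i fun h => hmem (h ▸ hi)]
        linarith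
    change ∑ i ∈ S, g s' i ≤ _
    change ∑ i ∈ S, g s i ≤ _ at ih
    linarith

lemma sysRun_clock_le_finish (hτ : ∀ i, 0 < τ i) (hw : IsArrivalOrder τ R w) (e : ℕ) (i : Fin n) :
    (sysRun τ R w e).clock ≤ (sysRun τ R w e).finish i := by
  cases e with
  | zero => simpa [sysRun, sysInit] using (hτ i).le
  | succ e =>
    have h := hw e i
    simp only [sysRun, SysState.step, Function.update_apply]
    split_ifs with hi
    · linarith [hτ (w e)]
    · exact h

lemma harmonicMean_pos (hτ : ∀ i, 0 < τ i) (m : Fin n) : 0 < harmonicMean τ m := by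
  unfold harmonicMean
  have : 0 < ∑ i ∈ Finset.Iic m, 1 / τ i :=
    Finset.sum_pos (fun i _ => one_div_pos.2 (hτ i)) ⟨m, by simp⟩
  positivity

/-- At time `t` worker `i` has computed for `t / τ i` gradients, the current one included. Summing
the potential bound over the workers up to `m` loses nothing that matters, since updates from other
workers only help. -/
lemma sysRun_clock_le (hτ : ∀ i, 0 < τ i) (hw : IsArrivalOrder τ R w) (hR1 : ∀ k, 1 ≤ R k)
    (hR : ∀ k : ℕ, √(k : ℝ) ≤ R k) (m : Fin n) (e : ℕ) :
    (sysRun τ R w e).clock ≤ harmonicMean τ m *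
      ((sysRun τ R w e).updates / ((m : ℕ) + 1 : ℝ) + 1 + 2 * √((sysRun τ R w e).updates : ℝ)) := by
  set s := sysRun τ R w e with hs
  have h := sum_arrivals_le_updates (w := w) hτ hR1 hR (Finset.Iic m) e
  have hcard : ((Finset.Iic m).card : ℝ) = (m : ℕ) + 1 := by simp
  have hm : (0 : ℝ) < (m : ℕ) + 1 := by positivity
  set Q := ∑ i ∈ Finset.Iic m, 1 / τ i with hQ
  have hQpos : 0 < Q := Finset.sum_pos (fun i _ => one_div_pos.2 (hτ i)) ⟨m, by simp⟩
  have hlow : s.clock * Q - ((m : ℕ) + 1) * (1 + 2 * √(s.updates : ℝ)) ≤ s.updates := by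
    refine le_trans ?_ h
    rw [hQ, Finset.mul_sum, ← hcard, ← nsmul_eq_mul, ← Finset.sum_const, ← Finset.sum_sub_distrib]
    refine Finset.sum_le_sum fun i _ => ?_
    have h1 : s.clock * (1 / τ i) ≤ s.finish i / τ i := by
      rw [mul_one_div]
      exact div_le_div_of_nonneg_right (sysRun_clock_le_finish hτ hw e i) (hτ i).le
    have h2 : √(s.startIdx i : ℝ) ≤ √(s.updates : ℝ) :=
      Real.sqrt_le_sqrt (by exact_mod_cast sysRun_startIdx_le e i)
    linarith
  have hH : harmonicMean τ m = ((m : ℕ) + 1) / Q := by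
    unfold harmonicMean
    rw [← hQ, mul_inv, one_div, inv_inv, div_eq_mul_inv]
  rw [hH, div_mul_eq_mul_div, le_div_iff₀ hQpos]
  have : ((m : ℕ) + 1 : ℝ) * (s.updates / ((m : ℕ) + 1 : ℝ) + 1 + 2 * √(s.updates : ℝ)) =
      s.updates + ((m : ℕ) + 1) * (1 + 2 * √(s.updates : ℝ)) := by field_simp; ring
  rw [this]
  linarith

lemma sum_finish_div (hτ : ∀ i, 0 < τ i) (e : ℕ) :
    ∑ i, (sysRun τ R w e).finish i / τ i = n + e := by
  induction e with
  | zero =>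
    have : ∀ i, τ i / τ i = 1 := fun i => div_self (hτ i).ne'
    simp [sysRun, sysInit, this]
  | succ e ih =>
    rw [← Finset.add_sum_erase _ _ (Finset.mem_univ (w e))] at ih ⊢
    have h1 : ∑ i ∈ Finset.univ.erase (w e), (sysRun τ R w (e + 1)).finish i / τ i =
        ∑ i ∈ Finset.univ.erase (w e), (sysRun τ R w e).finish i / τ i := by
      refine Finset.sum_congr rfl fun i hi => ?_
      simp [sysRun, SysState.step, Finset.ne_of_mem_erase hi]
    have h2 : (sysRun τ R w (e + 1)).finish (w e) / τ (w e) =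
        (sysRun τ R w e).finish (w e) / τ (w e) + 1 := by
      have := (hτ (w e)).ne'
      simp only [sysRun, SysState.step, Function.update_self]
      rw [add_div, div_self this]
    rw [h1, h2]
    push_cast
    linarith

/-- With at most `U` updates there could be at most `U + 2 n √U` arrivals, but arrivals never stop.
-/
lemma exists_lt_updates (hτ : ∀ i, 0 < τ i) (hR1 : ∀ k, 1 ≤ R k)
    (hR : ∀ k : ℕ, √(k : ℝ) ≤ R k) (U : ℕ) : ∃ e, U < (sysRun τ R w e).updates := by
  by_contra! hcon
  obtain ⟨e, he⟩ := exists_nat_gt ((U : ℝ) + n * (2 * √(U : ℝ)))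
  have h := sum_arrivals_le_updates (w := w) hτ hR1 hR Finset.univ e
  have h1 : ∑ i, ((sysRun τ R w e).finish i / τ i - 1 - 2 * √(U : ℝ)) ≤
      ∑ i, ((sysRun τ R w e).finish i / τ i - 1 - 2 * √((sysRun τ R w e).startIdx i : ℝ)) := by
    refine Finset.sum_le_sum fun i _ => ?_
    have : √((sysRun τ R w e).startIdx i : ℝ) ≤ √(U : ℝ) :=
      Real.sqrt_le_sqrt (by exact_mod_cast (sysRun_startIdx_le e i).trans (hcon e))
    linarith
  simp only [Finset.sum_sub_distrib, sum_finish_div hτ] at h1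
  simp only [Finset.sum_const, Finset.card_univ, Fintype.card_fin, nsmul_eq_mul, mul_one] at h1
  have h2 : ((sysRun τ R w e).updates : ℝ) ≤ U := by exact_mod_cast hcon e
  simp only [Finset.sum_sub_distrib, sum_finish_div hτ, Finset.sum_const, Finset.card_univ,
    Fintype.card_fin, nsmul_eq_mul, mul_one] at h
  linarith

/-- The arrival at which update number `k` is performed. -/
lemma exists_accepting_arrival (hτ : ∀ i, 0 < τ i) (hR1 : ∀ k, 1 ≤ R k)
    (hR : ∀ k : ℕ, √(k : ℝ) ≤ R k) (k : ℕ) :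
    ∃ e, (sysRun τ R w e).updates = k ∧ (sysRun τ R w (e + 1)).updates = k + 1 := by
  have hex := exists_lt_updates (w := w) hτ hR1 hR k
  classical
  have hspec := Nat.find_spec hex
  have hmin := fun m => Nat.find_min hex (m := m)
  cases hE : Nat.find hex with
  | zero => rw [hE] at hspec; simp [sysRun, sysInit] at hspec
  | succ e =>
    rw [hE] at hspec
    have h1 := hmin e (by omega)
    have h2 := (sysRun τ R w e).nextUpdates_le (R := R) (w e)
    rw [← sysRun_updates_succ] at h2
    exact ⟨e, by omega, by omega⟩

end System

/-! ### The iterates as a function of the number of updates -/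

section Iterates

variable {d n : ℕ} {Ξ : Type*} {τ : Fin n → ℝ} {w : ℕ → Fin n} {p : AlgParams}
  {lmo : Vec d → Vec d} {F : Vec d → Ξ → ℝ} {x₀ m₀ : Vec d} {ζ : Fin n → ℕ → Ξ}

lemma optRun_succ_of_updates_eq {e : ℕ}
    (h : (sysRun τ p.R w (e + 1)).updates = (sysRun τ p.R w e).updates) :
    (optRun p lmo F x₀ m₀ τ w ζ (e + 1)).x = (optRun p lmo F x₀ m₀ τ w ζ e).x ∧
    (optRun p lmo F x₀ m₀ τ w ζ (e + 1)).m = (optRun p lmo F x₀ m₀ τ w ζ e).m := by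
  rw [sysRun_updates_succ, SysState.nextUpdates] at h
  split_ifs at h with hd
  · omega
  · simp [optRun, OptState.step, hd]

/-- Discarded gradients change neither the iterate nor the momentum, so both are functions of the
number of updates. -/
lemma optRun_eq_of_updates_eq {e e' : ℕ}
    (h : (sysRun τ p.R w e).updates = (sysRun τ p.R w e').updates) :
    (optRun p lmo F x₀ m₀ τ w ζ e).x = (optRun p lmo F x₀ m₀ τ w ζ e').x ∧
    (optRun p lmo F x₀ m₀ τ w ζ e).m = (optRun p lmo F x₀ m₀ τ w ζ e').m := by
  have key : ∀ a b, (sysRun τ p.R w a).updates = (sysRun τ p.R w (a + b)).updates →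
      (optRun p lmo F x₀ m₀ τ w ζ a).x = (optRun p lmo F x₀ m₀ τ w ζ (a + b)).x ∧
      (optRun p lmo F x₀ m₀ τ w ζ a).m = (optRun p lmo F x₀ m₀ τ w ζ (a + b)).m := by
    intro a b
    induction b with
    | zero => exact fun _ => ⟨rfl, rfl⟩
    | succ b ih =>
      intro hab
      have h1 := sysRun_updates_mono (τ := τ) (R := p.R) (w := w) (Nat.le_add_right a b)
      have h2 := sysRun_updates_mono (τ := τ) (R := p.R) (w := w) (Nat.le_succ (a + b))
      simp only [Nat.succ_eq_add_one] at h1 h2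
      rw [← add_assoc] at hab ⊢
      have h3 := ih (by omega)
      have h4 := optRun_succ_of_updates_eq (p := p) (lmo := lmo) (F := F) (x₀ := x₀) (m₀ := m₀)
        (τ := τ) (w := w) (ζ := ζ) (e := a + b) (by omega)
      exact ⟨h3.1.trans h4.1.symm, h3.2.trans h4.2.symm⟩
  rcases le_total e e' with hle | hle
  · obtain ⟨b, rfl⟩ := Nat.exists_eq_add_of_le hle
    exact key e b h
  · obtain ⟨b, rfl⟩ := Nat.exists_eq_add_of_le hle
    exact (key e' b h.symm).imp Eq.symm Eq.symm

lemma optRun_held (e : ℕ) (i : Fin n) : ∃ e',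
    (sysRun τ p.R w e').updates = (sysRun τ p.R w e).startIdx i ∧
    (optRun p lmo F x₀ m₀ τ w ζ e).held i = (optRun p lmo F x₀ m₀ τ w ζ e').x := by
  induction e with
  | zero => exact ⟨0, rfl, rfl⟩
  | succ e ih =>
    by_cases hi : i = w e
    · refine ⟨e + 1, ?_, ?_⟩
      · rw [sysRun_startIdx_succ, if_pos hi]
      · simp only [optRun, OptState.step]
        split_ifs <;> simp [hi]
    · obtain ⟨e', h1, h2⟩ := ih
      refine ⟨e', ?_, ?_⟩
      · rw [sysRun_startIdx_succ, if_neg hi, h1]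
      · rw [← h2]
        simp only [optRun, OptState.step]
        split_ifs <;> simp [hi]

/-- Ringmaster LMO as a recursion indexed by updates: update `k` uses the gradient of worker
`q k`, computed at the iterate of index `s k`. -/
theorem exists_update_recursion (p : AlgParams) (lmo : Vec d → Vec d) (F : Vec d → Ξ → ℝ)
    (x₀ m₀ : Vec d) (hτ : ∀ i, 0 < τ i) (hR1 : ∀ k, 1 ≤ p.R k)
    (hR : ∀ k : ℕ, √(k : ℝ) ≤ p.R k) (w : ℕ → Fin n) :
    ∃ (q : ℕ → Fin n) (s : ℕ → ℕ) (X M : (Fin n → ℕ → Ξ) → ℕ → Vec d),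
      (∀ k, s k ≤ k) ∧ (∀ k : ℕ, (k : ℝ) - s k < p.R k) ∧
      Function.Injective (fun k => (q k, s k)) ∧
      (∀ ζ, X ζ 0 = x₀) ∧ (∀ ζ, M ζ 0 = m₀) ∧
      (∀ ζ k, M ζ (k + 1) = p.momentum k (M ζ k) (stochGrad F (X ζ (s k)) (ζ (q k) (s k)))) ∧
      (∀ ζ k, X ζ (k + 1) = X ζ k + p.η k • lmo (M ζ (k + 1))) ∧
      (∀ ζ e, (optRun p lmo F x₀ m₀ τ w ζ e).x = X ζ (sysRun τ p.R w e).updates) := by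
  -- `E k` is the arrival that performs update `k`. Reading the run at these arrivals gives the
  -- sequences indexed by updates.
  choose E hE hE' using exists_accepting_arrival (τ := τ) (w := w) hτ hR1 hR
  have hacc : ∀ k, (sysRun τ p.R w (E k)).delay (w (E k)) < p.R k := by
    intro k
    by_contra hcon
    have h1 := hE' k
    rw [sysRun_updates_succ, SysState.nextUpdates, hE, if_neg hcon] at h1
    omega
  have hx : ∀ ζ e k, (sysRun τ p.R w e).updates = k →
      (optRun p lmo F x₀ m₀ τ w ζ e).x = (optRun p lmo F x₀ m₀ τ w ζ (E k)).x ∧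
      (optRun p lmo F x₀ m₀ τ w ζ e).m = (optRun p lmo F x₀ m₀ τ w ζ (E k)).m :=
    fun ζ e k h => optRun_eq_of_updates_eq (h.trans (hE k).symm)
  have hm : ∀ ζ k, (optRun p lmo F x₀ m₀ τ w ζ (E (k + 1))).m =
      p.momentum k (optRun p lmo F x₀ m₀ τ w ζ (E k)).m
        (stochGrad F (optRun p lmo F x₀ m₀ τ w ζ
          (E ((sysRun τ p.R w (E k)).startIdx (w (E k))))).x
          (ζ (w (E k)) ((sysRun τ p.R w (E k)).startIdx (w (E k))))) := by
    intro ζ k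
    obtain ⟨e', h1, h2⟩ := optRun_held (p := p) (lmo := lmo) (F := F) (x₀ := x₀) (m₀ := m₀)
      (τ := τ) (w := w) (ζ := ζ) (E k) (w (E k))
    rw [← (hx ζ (E k + 1) (k + 1) (hE' k)).2, ← (hx ζ e' _ h1).1, ← h2]
    simp only [optRun, OptState.step, hE k, if_pos (hacc k)]
  refine ⟨fun k => w (E k), fun k => (sysRun τ p.R w (E k)).startIdx (w (E k)),
    fun ζ k => (optRun p lmo F x₀ m₀ τ w ζ (E k)).x,
    fun ζ k => (optRun p lmo F x₀ m₀ τ w ζ (E k)).m, ?_, ?_, ?_, ?_, ?_, hm, ?_, ?_⟩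
  · intro k
    simpa only [hE] using sysRun_startIdx_le (τ := τ) (R := p.R) (w := w) (E k) (w (E k))
  · intro k
    have := hacc k
    rw [SysState.delay, hE] at this
    exact this
  · refine (injective_arrival (τ := τ) (w := w) hR1).comp fun a b hab => ?_
    rw [← hE a, ← hE b, hab]
  · exact fun ζ => (hx ζ 0 0 rfl).1.symm
  · exact fun ζ => (hx ζ 0 0 rfl).2.symm
  · intro ζ k
    beta_reduce
    rw [← (hx ζ (E k + 1) (k + 1) (hE' k)).1, ← (hx ζ (E k + 1) (k + 1) (hE' k)).2]
    simp only [optRun, OptState.step, hE k, if_pos (hacc k)]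
  · exact fun ζ e => (hx ζ e _ rfl).1

end Iterates

/-! ### The schedule -/

section Schedule

/-- The fourth root of `k + 1`. -/
noncomputable def fourthRoot (k : ℕ) : ℝ := ((k : ℝ) + 1) ^ (1 / 4 : ℝ)

lemma fourthRoot_pow_four (k : ℕ) : fourthRoot k ^ 4 = k + 1 := by
  rw [fourthRoot, ← Real.rpow_natCast, ← Real.rpow_mul (by positivity)]
  norm_num

lemma one_le_fourthRoot (k : ℕ) : 1 ≤ fourthRoot k :=
  Real.one_le_rpow (by simp) (by norm_num)

lemma fourthRoot_pos (k : ℕ) : 0 < fourthRoot k := one_pos.trans_le (one_le_fourthRoot k)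

lemma fourthRoot_mono : Monotone fourthRoot := fun i j h =>
  Real.rpow_le_rpow (by positivity) (by simpa using h) (by norm_num)

lemma agnosticMomentum_zero : agnosticMomentum 0 = 1 := by simp [agnosticMomentum]

lemma sqrt_succ_eq (k : ℕ) : √((k + 1 : ℕ) : ℝ) = fourthRoot k ^ 2 := by
  rw [Real.sqrt_eq_iff_mul_self_eq (by positivity) (by positivity)]
  have := fourthRoot_pow_four k
  push_cast
  rw [← this]
  ring

lemma agnosticMomentum_succ (k : ℕ) : agnosticMomentum (k + 1) = 1 / fourthRoot k ^ 2 := by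
  rw [← sqrt_succ_eq, agnosticMomentum, if_neg (Nat.succ_ne_zero k),
    Real.rpow_neg (Nat.cast_nonneg _), Real.sqrt_eq_rpow, one_div, one_div]

lemma agnosticMomentum_nonneg (k : ℕ) : 0 ≤ agnosticMomentum k := by
  cases k with
  | zero => simp [agnosticMomentum_zero]
  | succ k => rw [agnosticMomentum_succ]; positivity

lemma agnosticMomentum_le_one (k : ℕ) : agnosticMomentum k ≤ 1 := by
  cases k with
  | zero => simp [agnosticMomentum_zero]
  | succ k =>
    rw [agnosticMomentum_succ, div_le_one (by have := fourthRoot_pos k; positivity)]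
    nlinarith [one_le_fourthRoot k]

lemma agnosticParams_η (c : ℝ) (k : ℕ) : (agnosticParams c).η k = c / fourthRoot k ^ 3 := by
  have : fourthRoot k ^ 3 = ((k : ℝ) + 1) ^ (3 / 4 : ℝ) := by
    rw [fourthRoot, ← Real.rpow_natCast, ← Real.rpow_mul (by positivity)]
    norm_num
  rw [this]
  rfl

lemma cube_le_two_mul_cube {u v : ℝ} (hu : 0 < u) (huv : u ≤ v) (h : v ^ 4 ≤ 2 * u ^ 4) :
    v ^ 3 ≤ 2 * u ^ 3 := by
  have hv : 0 < v := hu.trans_le huv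
  have h1 : v ^ 3 * u ≤ 2 * u ^ 3 * u := by
    calc v ^ 3 * u ≤ v ^ 3 * v := by gcongr
      _ = v ^ 4 := by ring
      _ ≤ 2 * u ^ 4 := h
      _ = _ := by ring
  exact le_of_mul_le_mul_right h1 hu

/-- Stepsizes at two iterations whose indices differ by a factor of at most two. -/
lemma stepsize_le_two_mul {a : ℝ} (ha : 0 ≤ a) {r k : ℕ} (hrk : r ≤ k)
    (h : (k : ℝ) + 1 ≤ 2 * (r + 1)) :
    a / fourthRoot r ^ 3 ≤ 2 * a / fourthRoot k ^ 3 := by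
  have hr := fourthRoot_pos r
  have hk := fourthRoot_pos k
  have h1 := cube_le_two_mul_cube hr (fourthRoot_mono hrk)
    (by rw [fourthRoot_pow_four, fourthRoot_pow_four]; exact h)
  rw [div_le_div_iff₀ (by positivity) (by positivity)]
  nlinarith

/-- With `u`, `v` consecutive fourth roots, `v ^ 4 - u ^ 4 = 1` gives `1 / v ^ 3 ≤ 4 (v - u)`, and
the sum telescopes. -/
lemma sum_inv_fourthRoot_cube_le (k : ℕ) :
    ∑ r ∈ Finset.range k, 1 / fourthRoot r ^ 3 ≤ 4 * fourthRoot k := by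
  have key : ∀ k, ∑ r ∈ Finset.range (k + 1), 1 / fourthRoot r ^ 3 ≤ 4 * fourthRoot k := by
    intro k
    induction k with
    | zero => simp [fourthRoot]
    | succ k ih =>
      rw [Finset.sum_range_succ]
      have h0 := fourthRoot_pos k
      have h1 := fourthRoot_pos (k + 1)
      have h2 := fourthRoot_mono k.le_succ
      simp only [Nat.succ_eq_add_one] at h2
      have h3 := fourthRoot_pow_four k
      have h4 := fourthRoot_pow_four (k + 1)
      push_cast at h4
      set u := fourthRoot k
      set v := fourthRoot (k + 1)
      have h5 : 1 / v ^ 3 ≤ 4 * (v - u) := by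
        rw [div_le_iff₀ (by positivity)]
        have h6 : (v - u) * (v ^ 3 + v ^ 2 * u + v * u ^ 2 + u ^ 3) = 1 := by nlinarith
        have h7 : v ^ 2 * u ≤ v ^ 3 := by
          calc v ^ 2 * u ≤ v ^ 2 * v := by gcongr
            _ = v ^ 3 := by ring
        have h8 : v * u ^ 2 ≤ v ^ 3 := by
          calc v * u ^ 2 ≤ v * v ^ 2 := by gcongr
            _ = v ^ 3 := by ring
        have h9 : u ^ 3 ≤ v ^ 3 := by gcongr
        have h10 : 0 ≤ v - u := by linarith
        nlinarith
      linarith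
  cases k with
  | zero => simpa using (fourthRoot_pos 0).le
  | succ k => exact (key k).trans (by have := fourthRoot_mono k.le_succ; simpa using this)

/-- The weighted sum of a geometrically damped sequence is controlled by its increments. -/
lemma sum_damped_le {a : ℝ} (ha : 0 ≤ a) {r B : ℕ → ℝ} (hr : ∀ k, 0 ≤ r k) (h0 : r 0 ≤ B 0)
    (hstep : ∀ k, r (k + 1) ≤ (1 - agnosticMomentum (k + 1)) * r k + B (k + 1)) (K : ℕ) :
    ∑ k ∈ Finset.range K, a / fourthRoot k ^ 3 * r k ≤
      ∑ k ∈ Finset.range K, a / fourthRoot k * B k := by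
  -- The weight `a / q K` is stepsize over momentum weight. As `α_{K+1} = 1 / q K ^ 2`, the part
  -- damped away from `a / q K * r K` is exactly the next summand `a / q K ^ 3 * r K`, so the
  -- induction closes.
  have key : ∀ K, ∑ k ∈ Finset.range K, a / fourthRoot k ^ 3 * r k + a / fourthRoot K * r K ≤
      ∑ k ∈ Finset.range (K + 1), a / fourthRoot k * B k := by
    intro K
    induction K with
    | zero =>
      have := fourthRoot_pos 0
      simp only [Finset.range_zero, Finset.sum_empty, zero_add, Finset.sum_range_one]
      gcongr
    | succ K ih =>
      rw [Finset.sum_range_succ, Finset.sum_range_succ _ (K + 1)]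
      have h1 := fourthRoot_pos K
      have h2 := fourthRoot_pos (K + 1)
      have h3 : a / fourthRoot (K + 1) ≤ a / fourthRoot K := by
        have := fourthRoot_mono K.le_succ
        gcongr
      have h4 : 0 ≤ (1 - agnosticMomentum (K + 1)) * r K :=
        mul_nonneg (by linarith [agnosticMomentum_le_one (K + 1)]) (hr K)
      have h5 : a / fourthRoot (K + 1) * r (K + 1) ≤
          a / fourthRoot K * ((1 - agnosticMomentum (K + 1)) * r K) +
            a / fourthRoot (K + 1) * B (K + 1) := by
        calc a / fourthRoot (K + 1) * r (K + 1)
            ≤ a / fourthRoot (K + 1) * ((1 - agnosticMomentum (K + 1)) * r K + B (K + 1)) := by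
              gcongr; exact hstep K
          _ = a / fourthRoot (K + 1) * ((1 - agnosticMomentum (K + 1)) * r K) +
              a / fourthRoot (K + 1) * B (K + 1) := by ring
          _ ≤ _ := by gcongr
      have h6 : a / fourthRoot K * ((1 - agnosticMomentum (K + 1)) * r K) +
          a / fourthRoot K ^ 3 * r K = a / fourthRoot K * r K := by
        rw [agnosticMomentum_succ]
        field_simp
        ring
      linarith
  cases K with
  | zero => simp
  | succ K =>
    refine le_trans ?_ (key K)
    rw [Finset.sum_range_succ]
    have h1 := one_le_fourthRoot K
    have h2 : a / fourthRoot K ^ 3 ≤ a / fourthRoot K := by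
      gcongr
      exact le_self_pow₀ h1 (by norm_num)
    have := mul_le_mul_of_nonneg_right h2 (hr K)
    linarith

end Schedule

/-! ### Descent along a trajectory -/

section Pathwise

variable {d : ℕ}

/-- Exponentially averaged gradient noise. -/
noncomputable def averagedNoise (ν : ℕ → Vec d) : ℕ → Vec d
  | 0 => 0
  | k + 1 => (1 - agnosticMomentum k) • averagedNoise ν k + agnosticMomentum k • ν k

/-- A trajectory of momentum LMO with stale gradients: update `k` uses the gradient at the iterate
of index `s k`, perturbed by `ν k`. -/
structure IsStaleTrajectory (f : Vec d → ℝ) (lmo : Vec d → Vec d) (a : ℝ) (s : ℕ → ℕ)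
    (ν x M : ℕ → Vec d) : Prop where
  le : ∀ k, s k ≤ k
  delay_lt : ∀ k : ℕ, (k : ℝ) + 1 - s (k + 1) < fourthRoot k ^ 2
  M_succ : ∀ k, M (k + 1) =
    (1 - agnosticMomentum k) • M k + agnosticMomentum k • (gradient f (x (s k)) + ν k)
  x_succ : ∀ k, x (k + 1) = x k + (a / fourthRoot k ^ 3) • lmo (M (k + 1))

variable {N : Seminorm ℝ (Vec d)} {f : Vec d → ℝ} {L₀ L₁ : ℝ} {lmo : Vec d → Vec d} {a : ℝ}
  {s : ℕ → ℕ} {ν x M : ℕ → Vec d}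

lemma IsStaleTrajectory.seminorm_sub_le (h : IsStaleTrajectory f lmo a s ν x M) (ha : 0 ≤ a)
    (hlmo : IsLMO N lmo) {i k : ℕ} (hik : i ≤ k) :
    N (x k - x i) ≤ ∑ r ∈ Finset.Ico i k, a / fourthRoot r ^ 3 := by
  induction k, hik using Nat.le_induction with
  | base => simp
  | succ k hik ih =>
    rw [Finset.sum_Ico_succ_top hik, h.x_succ, add_sub_right_comm]
    have hη : 0 ≤ a / fourthRoot k ^ 3 := by have := fourthRoot_pos k; positivity
    refine (map_add_le_add N _ _).trans (add_le_add ih ?_)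
    rw [map_smul_eq_mul, Real.norm_of_nonneg hη]
    exact mul_le_of_le_one_right hη (hlmo.seminorm_le_one _)

lemma IsStaleTrajectory.seminorm_sub_zero_le (h : IsStaleTrajectory f lmo a s ν x M) (ha : 0 ≤ a)
    (hlmo : IsLMO N lmo) (k : ℕ) : N (x k - x 0) ≤ 4 * a * fourthRoot k := by
  refine (h.seminorm_sub_le ha hlmo (Nat.zero_le k)).trans ?_
  have := sum_inv_fourthRoot_cube_le k
  rw [← Finset.range_eq_Ico]
  calc ∑ r ∈ Finset.range k, a / fourthRoot r ^ 3
      = a * ∑ r ∈ Finset.range k, 1 / fourthRoot r ^ 3 := by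
        rw [Finset.mul_sum]; simp only [mul_one_div]
    _ ≤ a * (4 * fourthRoot k) := by gcongr
    _ = _ := by ring

/-- The deterministic part of the momentum error. -/
noncomputable def momentumDrift (N : Seminorm ℝ (Vec d)) (f : Vec d → ℝ) (ν x M : ℕ → Vec d)
    (k : ℕ) : ℝ :=
  dualNorm N (M (k + 1) - averagedNoise ν (k + 1) - gradient f (x k))

lemma IsStaleTrajectory.momentumDrift_zero (h : IsStaleTrajectory f lmo a s ν x M) :
    momentumDrift N f ν x M 0 = 0 := by
  have h0 : s 0 = 0 := Nat.le_zero.1 (h.le 0)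
  rw [momentumDrift, h.M_succ, averagedNoise, averagedNoise, agnosticMomentum_zero, h0]
  simp [dualNorm_zero]

/-- The old average is compared with a gradient that moved by one step; the new gradient is up to `q
k ^ 2` steps old but enters with weight `1 / q k ^ 2`. Each costs one doubled stepsize, hence the
`4`. Smoothness is expanded at `x (k + 1)`, so that the error carries the gradient norm of the new
index. -/
lemma IsStaleTrajectory.momentumDrift_succ_le (h : IsStaleTrajectory f lmo a s ν x M)
    (ha : 0 ≤ a) (hN : IsNormOn N) (hlmo : IsLMO N lmo) (hf : GenSmooth N f L₀ L₁) (k : ℕ) :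
    momentumDrift N f ν x M (k + 1) ≤
      (1 - agnosticMomentum (k + 1)) * momentumDrift N f ν x M k +
        4 * (L₀ + L₁ * dualNorm N (gradient f (x (k + 1)))) * (a / fourthRoot (k + 1) ^ 3) *
          Real.exp (2 * (L₁ * a) / fourthRoot (k + 1)) := by
  have hL0 := hf.L₀_nonneg
  have hL1 := hf.L₁_nonneg
  have hG := dualNorm_nonneg hN (gradient f (x (k + 1)))
  have hq := fourthRoot_pos k
  have hq' := fourthRoot_pos (k + 1)
  have hq1' := one_le_fourthRoot (k + 1)
  have hqq : fourthRoot k ≤ fourthRoot (k + 1) := fourthRoot_mono k.le_succ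
  set α := agnosticMomentum (k + 1) with hα
  set D := L₀ + L₁ * dualNorm N (gradient f (x (k + 1))) with hD
  have hD0 : 0 ≤ D := by positivity
  have hα0 : 0 ≤ α := agnosticMomentum_nonneg _
  have hα1 : α ≤ 1 := agnosticMomentum_le_one _
  set g := gradient f (x (k + 1)) with hg
  set q' := fourthRoot (k + 1) with hq'def
  have hdecomp : M (k + 1 + 1) - averagedNoise ν (k + 1 + 1) - g =
      (1 - α) • (M (k + 1) - averagedNoise ν (k + 1) - gradient f (x k)) +
      ((1 - α) • (gradient f (x k) - g) + α • (gradient f (x (s (k + 1))) - g)) := by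
    rw [h.M_succ (k + 1), averagedNoise, ← hα]
    module
  have hE : ∀ X, X ≤ 2 * a / q' → Real.exp (L₁ * X) ≤ Real.exp (2 * (L₁ * a) / q') := by
    intro X hX
    refine Real.exp_le_exp.2 ?_
    calc L₁ * X ≤ L₁ * (2 * a / q') := by gcongr
      _ = _ := by ring
  have hcube : 2 * a / q' ^ 3 ≤ 2 * a / q' := by
    gcongr
    exact le_self_pow₀ hq1' (by norm_num)
  have h1 : dualNorm N (gradient f (x k) - g) ≤
      D * (2 * a / q' ^ 3) * Real.exp (2 * (L₁ * a) / q') := by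
    have hX : N (x k - x (k + 1)) ≤ 2 * a / q' ^ 3 := by
      rw [← map_neg_eq_map, neg_sub]
      refine (h.seminorm_sub_le ha hlmo k.le_succ).trans ?_
      simp only [Nat.succ_eq_add_one, Nat.Ico_succ_singleton, Finset.sum_singleton]
      refine stepsize_le_two_mul ha k.le_succ ?_
      push_cast
      nlinarith [Nat.cast_nonneg (α := ℝ) k]
    refine (hf.dualNorm_gradient_sub_le hN _ _ hX).trans ?_
    have := hE _ hcube
    gcongr
  have h2 : dualNorm N (gradient f (x (s (k + 1))) - g) ≤
      D * (fourthRoot k ^ 2 * (2 * a / q' ^ 3)) * Real.exp (2 * (L₁ * a) / q') := by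
    have hdel := h.delay_lt k
    have hs := h.le (k + 1)
    have hX : N (x (s (k + 1)) - x (k + 1)) ≤ fourthRoot k ^ 2 * (2 * a / q' ^ 3) := by
      rw [← map_neg_eq_map, neg_sub]
      refine (h.seminorm_sub_le ha hlmo hs).trans ?_
      have hbd : ∀ r ∈ Finset.Ico (s (k + 1)) (k + 1),
          a / fourthRoot r ^ 3 ≤ 2 * a / q' ^ 3 := by
        intro r hr
        rw [Finset.mem_Ico] at hr
        refine stepsize_le_two_mul ha hr.2.le ?_
        have h3 := fourthRoot_pow_four k
        have h4 : (s (k + 1) : ℝ) ≤ r := by exact_mod_cast hr.1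
        push_cast
        -- A delay `δ` with `δ ^ 2 ≤ k + 1` satisfies `2 δ ≤ δ ^ 2 + 1 ≤ k + 2`. So the indices in
        -- the delay window agree up to a factor of two, and the stepsizes do as well.
        have h5 : (fourthRoot k ^ 2) ^ 2 = k + 1 := by rw [← h3]; ring
        have h6 : (0 : ℝ) ≤ k + 1 - s (k + 1) := by
          have : (s (k + 1) : ℝ) ≤ (k + 1 : ℕ) := by exact_mod_cast hs
          push_cast at this
          linarith
        have h7 : ((k : ℝ) + 1 - s (k + 1)) ^ 2 ≤ (fourthRoot k ^ 2) ^ 2 := by gcongr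
        nlinarith [sq_nonneg ((k : ℝ) + 1 - s (k + 1) - 1)]
      refine (Finset.sum_le_card_nsmul _ _ _ hbd).trans ?_
      rw [Nat.card_Ico, nsmul_eq_mul, Nat.cast_sub hs]
      push_cast
      gcongr
    refine (hf.dualNorm_gradient_sub_le hN _ _ hX).trans ?_
    have : fourthRoot k ^ 2 * (2 * a / q' ^ 3) ≤ 2 * a / q' := by
      rw [mul_div_assoc', div_le_div_iff₀ (by positivity) hq']
      calc fourthRoot k ^ 2 * (2 * a) * q' ≤ q' ^ 2 * (2 * a) * q' := by gcongr
        _ = _ := by ring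
    have := hE _ this
    gcongr
  have hαq : α * fourthRoot k ^ 2 = 1 := by
    rw [hα, agnosticMomentum_succ]; field_simp
  rw [momentumDrift, hdecomp]
  refine (dualNorm_add_le hN _ _).trans (add_le_add (dualNorm_smul_le hN (by linarith) _) ?_)
  refine (dualNorm_add_le hN _ _).trans ?_
  have h3 := dualNorm_smul_le hN (r := 1 - α) (by linarith) (gradient f (x k) - g)
  have h4 := dualNorm_smul_le hN hα0 (gradient f (x (s (k + 1))) - g)
  have h5 : (1 - α) * dualNorm N (gradient f (x k) - g) ≤
      1 * (D * (2 * a / q' ^ 3) * Real.exp (2 * (L₁ * a) / q')) := by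
    have := dualNorm_nonneg hN (gradient f (x k) - g)
    gcongr
    linarith
  have h6 : α * dualNorm N (gradient f (x (s (k + 1))) - g) ≤
      α * (D * (fourthRoot k ^ 2 * (2 * a / q' ^ 3)) * Real.exp (2 * (L₁ * a) / q')) := by
    gcongr
  have h7 : α * (D * (fourthRoot k ^ 2 * (2 * a / q' ^ 3)) * Real.exp (2 * (L₁ * a) / q')) =
      D * (2 * a / q' ^ 3) * Real.exp (2 * (L₁ * a) / q') := by
    calc _ = (α * fourthRoot k ^ 2) * (D * (2 * a / q' ^ 3) *
          Real.exp (2 * (L₁ * a) / q')) := by ring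
      _ = _ := by rw [hαq, one_mul]
  calc _ ≤ 2 * (D * (2 * a / q' ^ 3) * Real.exp (2 * (L₁ * a) / q')) := by linarith
    _ = _ := by ring

/-- The oracle is exact for the momentum `m`, not for the gradient `g`. Replacing one by the other
costs `2 ‖m - g‖_*`: once in the inner product and once in the norm. -/
lemma IsStaleTrajectory.descent_step (h : IsStaleTrajectory f lmo a s ν x M)
    (ha : 0 ≤ a) (hN : IsNormOn N) (hlmo : IsLMO N lmo) (hf : GenSmooth N f L₀ L₁)
    (hdiff : Differentiable ℝ f) (k : ℕ) :
    a / fourthRoot k ^ 3 * dualNorm N (gradient f (x k)) ≤ f (x k) - f (x (k + 1)) +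
      2 * (a / fourthRoot k ^ 3 * dualNorm N (averagedNoise ν (k + 1))) +
      2 * (a / fourthRoot k ^ 3 * momentumDrift N f ν x M k) +
      a / fourthRoot k * ((L₀ + L₁ * dualNorm N (gradient f (x k))) * (a / fourthRoot k ^ 3) *
        Real.exp (2 * (L₁ * a) / fourthRoot k)) := by
  have hL0 := hf.L₀_nonneg
  have hL1 := hf.L₁_nonneg
  have hq := fourthRoot_pos k
  have hq1 := one_le_fourthRoot k
  have hG := dualNorm_nonneg hN (gradient f (x k))
  set q := fourthRoot k
  set g := gradient f (x k) with hg
  set m := M (k + 1) with hm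
  set η := a / q ^ 3 with hη
  have hη0 : 0 ≤ η := by positivity
  have hηq : η ≤ a / q := by
    rw [hη]
    gcongr
    exact le_self_pow₀ hq1 (by norm_num)
  have hle : N (η • lmo m) ≤ η := by
    rw [map_smul_eq_mul, Real.norm_of_nonneg hη0]
    exact mul_le_of_le_one_right hη0 (hlmo.seminorm_le_one _)
  have h1 := hf.descent hN hdiff (x k) (η • lmo m) hle
  rw [← h.x_succ k, ← hg, inner_smul_right] at h1
  have h2 : (inner ℝ g (lmo m) : ℝ) ≤ -dualNorm N g + 2 * dualNorm N (m - g) := by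
    have h3 := hlmo.inner_le m
    have h4 := inner_le_dualNorm_of_le_one hN (g - m) (hlmo.seminorm_le_one m)
    rw [inner_sub_left, dualNorm_sub_comm hN] at h4
    have h5 := dualNorm_le_add_sub hN g m
    rw [dualNorm_sub_comm hN] at h5
    linarith
  have h6 : dualNorm N (m - g) ≤
      dualNorm N (averagedNoise ν (k + 1)) + momentumDrift N f ν x M k := by
    have := dualNorm_add_le hN (averagedNoise ν (k + 1)) (m - averagedNoise ν (k + 1) - g)
    rw [show averagedNoise ν (k + 1) + (m - averagedNoise ν (k + 1) - g) = m - g by abel] at this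
    exact this
  have h7 : η * (inner ℝ g (lmo m) : ℝ) ≤ η * (-dualNorm N g +
      2 * (dualNorm N (averagedNoise ν (k + 1)) + momentumDrift N f ν x M k)) := by
    gcongr
    linarith
  have h8 : (L₀ + L₁ * dualNorm N g) * η ^ 2 * Real.exp (L₁ * η) ≤
      a / q * ((L₀ + L₁ * dualNorm N g) * η * Real.exp (2 * (L₁ * a) / q)) := by
    have h9 : Real.exp (L₁ * η) ≤ Real.exp (2 * (L₁ * a) / q) := by
      refine Real.exp_le_exp.2 ?_
      calc L₁ * η ≤ L₁ * (a / q) := by gcongr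
        _ = 1 * (L₁ * (a / q)) := by ring
        _ ≤ 2 * (L₁ * (a / q)) := by gcongr; norm_num
        _ = _ := by ring
    calc (L₀ + L₁ * dualNorm N g) * η ^ 2 * Real.exp (L₁ * η)
        = η * ((L₀ + L₁ * dualNorm N g) * η * Real.exp (L₁ * η)) := by ring
      _ ≤ _ := by gcongr
  linarith

lemma exp_le_two_of_le {t : ℝ} (ht : t ≤ 1 / 2) : Real.exp t ≤ 2 := by
  have h1 := Real.add_one_le_exp (-t)
  have h2 : Real.exp t * Real.exp (-t) = 1 := by rw [← Real.exp_add]; simp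
  nlinarith [Real.exp_pos t]

/-- The error terms are absorbed by half of the gradient norm, up to a harmonic term. -/
lemma IsStaleTrajectory.absorb (h : IsStaleTrajectory f lmo a s ν x M)
    (ha : 0 ≤ a) (hN : IsNormOn N) (hlmo : IsLMO N lmo) (hf : GenSmooth N f L₀ L₁) (k : ℕ) :
    9 * (a / fourthRoot k) * (L₀ + L₁ * dualNorm N (gradient f (x k))) *
        Real.exp (2 * (L₁ * a) / fourthRoot k) ≤
      dualNorm N (gradient f (x k)) / 2 + (9 * a * L₀ * Real.exp (2 * (L₁ * a)) +
        9 * (L₁ * a) * Real.exp (2 * (L₁ * a)) * Real.exp (144 * (L₁ * a) ^ 2) *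
          (dualNorm N (gradient f (x 0)) + 144 * L₀ * a * (L₁ * a))) / fourthRoot k := by
  have hL0 := hf.L₀_nonneg
  have hL1 := hf.L₁_nonneg
  have hq := fourthRoot_pos k
  have hq1 := one_le_fourthRoot k
  have hG := dualNorm_nonneg hN (gradient f (x k))
  have hG0 := dualNorm_nonneg hN (gradient f (x 0))
  have hX := h.seminorm_sub_zero_le ha hlmo k
  set q := fourthRoot k
  set G := dualNorm N (gradient f (x k)) with hGdef
  set G0 := dualNorm N (gradient f (x 0))
  have hA : 0 ≤ L₁ * a := mul_nonneg hL1 ha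
  set A := L₁ * a with hAdef
  have hE : Real.exp (2 * A / q) ≤ Real.exp (2 * A) :=
    Real.exp_le_exp.2 (div_le_self (by positivity) hq1)
  have h1 : 9 * (a / q) * L₀ * Real.exp (2 * A / q) ≤ 9 * a * L₀ * Real.exp (2 * A) / q := by
    calc 9 * (a / q) * L₀ * Real.exp (2 * A / q) ≤ 9 * (a / q) * L₀ * Real.exp (2 * A) := by gcongr
      _ = _ := by ring
  have h2 : 9 * (A / q) * G * Real.exp (2 * A / q) ≤ G / 2 +
      9 * A * Real.exp (2 * A) * Real.exp (144 * A ^ 2) * (G0 + 144 * L₀ * a * A) / q := by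
    -- For `q ≥ 36 A` the coefficient is at most `9 · (1/36) · 2 = 1/2`. For `q < 36 A` the distance
    -- to `x 0` is at most `4 a q ≤ 144 a A`, and Grönwall from `x 0` bounds the gradient.
    rcases le_or_gt (36 * A) q with hlate | hearly
    · have h3 : A / q ≤ 1 / 36 := by rw [div_le_iff₀ hq]; linarith
      have h4 : Real.exp (2 * A / q) ≤ 2 := exp_le_two_of_le (by rw [mul_div_assoc]; linarith)
      have h5 : 9 * (A / q) * G * Real.exp (2 * A / q) ≤ 9 * (1 / 36) * G * 2 := by gcongr
      have h6 : 0 ≤ 9 * A * Real.exp (2 * A) * Real.exp (144 * A ^ 2) *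
          (G0 + 144 * L₀ * a * A) / q := by positivity
      linarith
    · have hX' : N (x k - x 0) ≤ 144 * a * A := by
        refine hX.trans ?_
        calc 4 * a * q ≤ 4 * a * (36 * A) := by gcongr
          _ = _ := by ring
      have h3 := hf.dualNorm_gradient_le hN (x k) (x 0) hX'
      have h4 : L₁ * (144 * a * A) = 144 * A ^ 2 := by rw [hAdef]; ring
      rw [h4] at h3
      have h5 : 9 * (A / q) * G * Real.exp (2 * A / q) ≤ 9 * (A / q) *
          (Real.exp (144 * A ^ 2) * (G0 + L₀ * (144 * a * A))) * Real.exp (2 * A) := by gcongr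
      calc _ ≤ _ := h5
        _ = 9 * A * Real.exp (2 * A) * Real.exp (144 * A ^ 2) * (G0 + 144 * L₀ * a * A) / q := by
          ring
        _ ≤ _ := by linarith
  calc 9 * (a / q) * (L₀ + L₁ * G) * Real.exp (2 * A / q)
      = 9 * (a / q) * L₀ * Real.exp (2 * A / q) + 9 * (A / q) * G * Real.exp (2 * A / q) := by
        rw [hAdef]; ring
    _ ≤ _ := add_le_add h1 h2
    _ = _ := by ring

theorem IsStaleTrajectory.sum_dualNorm_gradient_le (h : IsStaleTrajectory f lmo a s ν x M)
    (ha : 0 ≤ a) (hN : IsNormOn N) (hlmo : IsLMO N lmo) (hf : GenSmooth N f L₀ L₁)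
    (hdiff : Differentiable ℝ f) {fstar : ℝ} (hstar : ∀ y, fstar ≤ f y) (K : ℕ) :
    ∑ k ∈ Finset.range K, a / fourthRoot k ^ 3 * dualNorm N (gradient f (x k)) ≤
      2 * (f (x 0) - fstar) +
      4 * ∑ k ∈ Finset.range K, a / fourthRoot k ^ 3 * dualNorm N (averagedNoise ν (k + 1)) +
      2 * a * (9 * a * L₀ * Real.exp (2 * (L₁ * a)) +
        9 * (L₁ * a) * Real.exp (2 * (L₁ * a)) * Real.exp (144 * (L₁ * a) ^ 2) *
          (dualNorm N (gradient f (x 0)) + 144 * L₀ * a * (L₁ * a))) *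
        ∑ k ∈ Finset.range K, 1 / fourthRoot k ^ 4 := by
  have hL0 := hf.L₀_nonneg
  have hL1 := hf.L₁_nonneg
  set Q := 9 * a * L₀ * Real.exp (2 * (L₁ * a)) +
        9 * (L₁ * a) * Real.exp (2 * (L₁ * a)) * Real.exp (144 * (L₁ * a) ^ 2) *
          (dualNorm N (gradient f (x 0)) + 144 * L₀ * a * (L₁ * a)) with hQ
  set η : ℕ → ℝ := fun k => a / fourthRoot k ^ 3 with hη
  set G : ℕ → ℝ := fun k => dualNorm N (gradient f (x k)) with hGdef
  set W : ℕ → ℝ := fun k => a / fourthRoot k * ((L₀ + L₁ * G k) * η k *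
    Real.exp (2 * (L₁ * a) / fourthRoot k)) with hW
  have hdrift : ∑ k ∈ Finset.range K, η k * momentumDrift N f ν x M k ≤
      ∑ k ∈ Finset.range K, 4 * W k := by
    refine (sum_damped_le ha (r := momentumDrift N f ν x M) (B := fun k => 4 * (L₀ + L₁ * G k) *
      η k * Real.exp (2 * (L₁ * a) / fourthRoot k)) (fun k => dualNorm_nonneg hN _) ?_
      (fun k => h.momentumDrift_succ_le ha hN hlmo hf k) K).trans (le_of_eq ?_)
    · rw [h.momentumDrift_zero]
      have h1 := dualNorm_nonneg hN (gradient f (x 0))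
      have h2 := fourthRoot_pos 0
      simp only [hη, hGdef]
      positivity
    · refine Finset.sum_congr rfl fun k _ => ?_
      simp only [hW]
      ring
  have hsum := Finset.sum_le_sum fun k (_ : k ∈ Finset.range K) =>
    h.descent_step ha hN hlmo hf hdiff k
  simp only [Finset.sum_add_distrib, Finset.sum_range_sub', ← Finset.mul_sum] at hsum
  -- The `9` is one `W` from the quadratic term of the descent plus `2 · 4` from the drift.
  have habs : ∑ k ∈ Finset.range K, 9 * W k ≤
      ∑ k ∈ Finset.range K, (η k * G k / 2 + a * Q * (1 / fourthRoot k ^ 4)) := by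
    refine Finset.sum_le_sum fun k _ => ?_
    have h1 := h.absorb ha hN hlmo hf k
    have hq := fourthRoot_pos k
    have hη0 : 0 ≤ η k := by simp only [hη]; positivity
    have h2 := mul_le_mul_of_nonneg_left h1 hη0
    refine le_trans (le_of_eq ?_) (h2.trans (le_of_eq ?_))
    · simp only [hW]; ring
    · rw [← hQ]
      simp only [hη, hGdef]
      field_simp
  rw [Finset.sum_add_distrib, ← Finset.sum_div, ← Finset.mul_sum, ← Finset.mul_sum] at habs
  rw [← Finset.mul_sum] at hdrift
  have hK := hstar (x K)
  simp only [hη, hGdef, hW] at habs hdrift hsum ⊢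
  linarith

end Pathwise

/-! ### Stochastic gradients -/

section StochGrad

variable {d : ℕ} {Ξ : Type*} [MeasurableSpace Ξ] {𝒟 : Measure Ξ} {F : Vec d → Ξ → ℝ} {σ : ℝ}

/-- The loss is continuous in the point and measurable in the sample, hence jointly measurable. The
coordinates of the gradient are limits of its difference quotients. -/
lemma UnbiasedBoundedVariance.measurable_stochGrad (h : UnbiasedBoundedVariance 𝒟 F σ) :
    Measurable fun p : Vec d × Ξ => stochGrad F p.1 p.2 := by
  have hF : Measurable (Function.uncurry F) :=
    measurable_uncurry_of_continuous_of_measurable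
      (fun s => (h.differentiable_loss s).continuous) h.measurable_loss
  set b := EuclideanSpace.basisFun (Fin d) ℝ
  have hcoord : ∀ i, Measurable fun p : Vec d × Ξ => (inner ℝ (b i) (stochGrad F p.1 p.2) : ℝ) := by
    intro i
    refine measurable_of_tendsto_metrizable (f := fun (m : ℕ) (p : Vec d × Ξ) =>
      (m : ℝ) • (F (p.1 + (m : ℝ)⁻¹ • b i) p.2 - F p.1 p.2)) (fun m => ?_) ?_
    · have h1 : Measurable fun p : Vec d × Ξ => F (p.1 + (m : ℝ)⁻¹ • b i) p.2 :=
        hF.comp ((measurable_fst.add_const _).prodMk measurable_snd)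
      exact (h1.sub hF).const_mul _
    · refine tendsto_pi_nhds.2 fun p => ?_
      have h1 := (h.differentiable_loss p.2 p.1).hasGradientAt.hasFDerivAt.lim_real (b i)
      rw [InnerProductSpace.toDual_apply_apply, real_inner_comm] at h1
      exact h1.comp tendsto_natCast_atTop_atTop
  have heq : (fun p : Vec d × Ξ => stochGrad F p.1 p.2) =
      fun p => ∑ i, (inner ℝ (b i) (stochGrad F p.1 p.2) : ℝ) • b i := by
    funext p
    exact (b.sum_repr' _).symm
  rw [heq]
  exact Finset.measurable_sum _ fun i _ => (hcoord i).smul_const _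

lemma measurable_gradient (f : Vec d → ℝ) : Measurable (gradient f) :=
  (InnerProductSpace.toDual ℝ (Vec d)).symm.continuous.measurable.comp (measurable_fderiv ℝ f)

variable {Ω : Type*} [MeasurableSpace Ω] {P : Measure Ω} [IsProbabilityMeasure P]
  [IsProbabilityMeasure 𝒟]

/-- The noise of a fresh stochastic gradient at a point `z` independent of the sample has second
moment at most `σ²` and is uncorrelated with everything that is independent of the sample. -/
lemma UnbiasedBoundedVariance.fresh_noise (h : UnbiasedBoundedVariance 𝒟 F σ)
    {u z : Ω → Vec d} {Z : Ω → Ξ} (hu : Measurable u) (hz : Measurable z) (hZ : Measurable Z)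
    (hlaw : P.map Z = 𝒟) (hindep : IndepFun (fun ω => (u ω, z ω)) Z P)
    (hu2 : Integrable (fun ω => ‖u ω‖ ^ 2) P) :
    Integrable (fun ω => ‖stochGrad F (z ω) (Z ω) - gradient (objective 𝒟 F) (z ω)‖ ^ 2) P ∧
    ∫ ω, ‖stochGrad F (z ω) (Z ω) - gradient (objective 𝒟 F) (z ω)‖ ^ 2 ∂P ≤ σ ^ 2 ∧
    Integrable (fun ω =>
      (inner ℝ (u ω) (stochGrad F (z ω) (Z ω) - gradient (objective 𝒟 F) (z ω)) : ℝ)) P ∧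
    ∫ ω, (inner ℝ (u ω) (stochGrad F (z ω) (Z ω) - gradient (objective 𝒟 F) (z ω)) : ℝ) ∂P = 0 := by
  set Y : Ω → Vec d × Vec d := fun ω => (u ω, z ω) with hY
  have hYm : Measurable Y := hu.prodMk hz
  set κ := P.map Y with hκ
  have : IsProbabilityMeasure κ := Measure.isProbabilityMeasure_map hYm.aemeasurable
  have hT : Measurable fun ω => (Y ω, Z ω) := hYm.prodMk hZ
  -- Independence makes the joint law a product, so by Fubini the point can be frozen and the moment
  -- assumptions at a fixed point apply.
  have hprod : P.map (fun ω => (Y ω, Z ω)) = κ.prod 𝒟 := by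
    rw [(indepFun_iff_map_prod_eq_prod_map_map hYm.aemeasurable hZ.aemeasurable).1 hindep, hlaw]
  set ν : (Vec d × Vec d) × Ξ → Vec d :=
    fun p => stochGrad F p.1.2 p.2 - gradient (objective 𝒟 F) p.1.2 with hν
  have hνm : Measurable ν :=
    (h.measurable_stochGrad.comp ((measurable_snd.comp measurable_fst).prodMk measurable_snd)).sub
      ((measurable_gradient _).comp (measurable_snd.comp measurable_fst))
  have hsq : Measurable fun p => ‖ν p‖ ^ 2 := hνm.norm.pow_const 2
  have hin : Measurable fun p : (Vec d × Vec d) × Ξ => (inner ℝ p.1.1 (ν p) : ℝ) :=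
    (measurable_fst.comp measurable_fst).inner hνm
  have hint : Integrable (fun p => ‖ν p‖ ^ 2) (κ.prod 𝒟) := by
    rw [integrable_prod_iff hsq.aestronglyMeasurable]
    refine ⟨Filter.Eventually.of_forall fun y => h.integrable_sq y.2, ?_⟩
    refine Integrable.of_bound (C := σ ^ 2)
      (hsq.norm.stronglyMeasurable.integral_prod_right).aestronglyMeasurable
      (Filter.Eventually.of_forall fun y => ?_)
    rw [Real.norm_of_nonneg (integral_nonneg fun _ => norm_nonneg _)]
    simpa [hν] using h.variance_le y.2
  have hintΩ : Integrable (fun ω => ‖ν (Y ω, Z ω)‖ ^ 2) P := by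
    rw [← hprod] at hint
    exact hint.comp_measurable hT
  have hinΩ : Integrable (fun ω => (inner ℝ (u ω) (ν (Y ω, Z ω)) : ℝ)) P := by
    refine (hu2.add hintΩ).mono' (hin.comp hT).aestronglyMeasurable
      (Filter.Eventually.of_forall fun ω => ?_)
    have h1 := norm_inner_le_norm (𝕜 := ℝ) (u ω) (ν (Y ω, Z ω))
    simp only [Pi.add_apply]
    nlinarith [sq_nonneg (‖u ω‖ - ‖ν (Y ω, Z ω)‖), sq_nonneg (‖u ω‖), sq_nonneg ‖ν (Y ω, Z ω)‖]
  refine ⟨hintΩ, ?_, hinΩ, ?_⟩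
  · have h1 : ∫ ω, ‖ν (Y ω, Z ω)‖ ^ 2 ∂P = ∫ p, ‖ν p‖ ^ 2 ∂(κ.prod 𝒟) := by
      rw [← hprod, integral_map hT.aemeasurable hsq.aestronglyMeasurable]
    change ∫ ω, ‖ν (Y ω, Z ω)‖ ^ 2 ∂P ≤ _
    rw [h1, integral_prod _ hint]
    calc ∫ y, ∫ t, ‖ν (y, t)‖ ^ 2 ∂𝒟 ∂κ ≤ ∫ _, σ ^ 2 ∂κ :=
          integral_mono hint.integral_prod_left (integrable_const _) fun y => h.variance_le y.2
      _ = σ ^ 2 := by simp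
  · have h1 : ∫ ω, (inner ℝ (u ω) (ν (Y ω, Z ω)) : ℝ) ∂P =
        ∫ p, (inner ℝ p.1.1 (ν p) : ℝ) ∂(κ.prod 𝒟) := by
      rw [← hprod, integral_map hT.aemeasurable hin.aestronglyMeasurable]
    have hinp : Integrable (fun p : (Vec d × Vec d) × Ξ => (inner ℝ p.1.1 (ν p) : ℝ))
        (κ.prod 𝒟) := by
      rw [← hprod, integrable_map_measure hin.aestronglyMeasurable hT.aemeasurable]
      exact hinΩ
    change ∫ ω, (inner ℝ (u ω) (ν (Y ω, Z ω)) : ℝ) ∂P = 0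
    rw [h1, integral_prod _ hinp]
    have h2 : ∀ y : Vec d × Vec d, ∫ t, (inner ℝ y.1 (ν (y, t)) : ℝ) ∂𝒟 = 0 := by
      intro y
      have h3 := (h.integrable_grad y.2).sub
        (integrable_const (μ := 𝒟) (gradient (objective 𝒟 F) y.2))
      refine (integral_inner h3 y.1).trans ?_
      simp only [Pi.sub_apply]
      rw [integral_sub (h.integrable_grad y.2) (integrable_const _), h.unbiased]
      simp
    simp [h2]

end StochGrad

/-! ### Averaged noise of the method -/

section AveragedNoise

/-- The information contained in the first `k` samples. -/
@[reducible]
def pastSamples {Ξ Ω : Type*} [MeasurableSpace Ξ] (Z : ℕ → Ω → Ξ) (k : ℕ) : MeasurableSpace Ω :=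
  ⨆ j ∈ Set.Iio k, MeasurableSpace.comap (Z j) inferInstance

variable {d : ℕ} {Ξ Ω : Type*} [MeasurableSpace Ξ] {Z : ℕ → Ω → Ξ}

lemma pastSamples_mono : Monotone (pastSamples Z) := fun _ _ h =>
  biSup_mono fun _ hj => lt_of_lt_of_le hj h

lemma measurable_pastSamples {j k : ℕ} (h : j < k) : Measurable[pastSamples Z k] (Z j) := by
  rw [measurable_iff_comap_le]
  exact le_iSup₂_of_le (f := fun j (_ : j ∈ Set.Iio k) => MeasurableSpace.comap (Z j) inferInstance)
    j h le_rfl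

/-- The gradient noise of update `k`. -/
noncomputable def updateNoise (f : Vec d → ℝ) (F : Vec d → Ξ → ℝ) (s : ℕ → ℕ) (Z : ℕ → Ω → Ξ)
    (x : Ω → ℕ → Vec d) (ω : Ω) (k : ℕ) : Vec d :=
  stochGrad F (x ω (s k)) (Z k ω) - gradient f (x ω (s k))

/-- The iterates of momentum LMO with stale gradients, driven by the samples `Z`. -/
structure IsStaleMethod (f : Vec d → ℝ) (F : Vec d → Ξ → ℝ) (lmo : Vec d → Vec d)
    (a : ℝ) (s : ℕ → ℕ) (Z : ℕ → Ω → Ξ) (x₀ m₀ : Vec d) (x M : Ω → ℕ → Vec d) : Prop where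
  le : ∀ k, s k ≤ k
  x_zero : ∀ ω, x ω 0 = x₀
  M_zero : ∀ ω, M ω 0 = m₀
  trajectory : ∀ ω, IsStaleTrajectory f lmo a s (updateNoise f F s Z x ω) (x ω) (M ω)

section Adapted

variable {𝒟 : Measure Ξ} {F : Vec d → Ξ → ℝ} {σ : ℝ} {lmo : Vec d → Vec d} {a : ℝ} {s : ℕ → ℕ}
  {x₀ m₀ : Vec d} {x M : Ω → ℕ → Vec d}

lemma measurable_updateNoise (hF : UnbiasedBoundedVariance 𝒟 F σ) {k : ℕ}
    (hx : Measurable[pastSamples Z (k + 1)] fun ω => x ω (s k)) :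
    Measurable[pastSamples Z (k + 1)]
      fun ω => updateNoise (objective 𝒟 F) F s Z x ω k := by
  let _ : MeasurableSpace Ω := pastSamples Z (k + 1)
  have hZ : Measurable (Z k) := measurable_pastSamples k.lt_succ_self
  exact (hF.measurable_stochGrad.comp (hx.prodMk hZ)).sub ((measurable_gradient _).comp hx)

lemma IsStaleMethod.measurable_past
    (h : IsStaleMethod (objective 𝒟 F) F lmo a s Z x₀ m₀ x M)
    (hF : UnbiasedBoundedVariance 𝒟 F σ) (hlmo : Measurable lmo) (k : ℕ) :
    Measurable[pastSamples Z k] (fun ω => M ω k) ∧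
      ∀ j ≤ k, Measurable[pastSamples Z k] (fun ω => x ω j) := by
  induction k with
  | zero =>
    refine ⟨by simp only [h.M_zero]; exact measurable_const, fun j hj => ?_⟩
    obtain rfl := Nat.le_zero.1 hj
    simp only [h.x_zero]
    exact measurable_const
  | succ k ih =>
    have hle : pastSamples Z k ≤ pastSamples Z (k + 1) := pastSamples_mono k.le_succ
    let _ : MeasurableSpace Ω := pastSamples Z (k + 1)
    have hx : ∀ j ≤ k, Measurable fun ω => x ω j := fun j hj => (ih.2 j hj).mono hle le_rfl
    have hM0 : Measurable fun ω => M ω k := ih.1.mono hle le_rfl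
    have hν : Measurable fun ω => updateNoise (objective 𝒟 F) F s Z x ω k :=
      measurable_updateNoise hF (hx _ (h.le k))
    have hM : Measurable fun ω => M ω (k + 1) := by
      simp only [fun ω => (h.trajectory ω).M_succ k]
      have hg : Measurable fun ω => gradient (objective 𝒟 F) (x ω (s k)) :=
        (measurable_gradient _).comp (hx _ (h.le k))
      exact (hM0.const_smul (1 - agnosticMomentum k)).add
        ((hg.add hν).const_smul (agnosticMomentum k))
    refine ⟨hM, fun j hj => ?_⟩
    rcases Nat.lt_or_eq_of_le hj with hj | rfl
    · exact hx j (by omega)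
    · simp only [fun ω => (h.trajectory ω).x_succ k]
      have hl : Measurable fun ω => lmo (M ω (k + 1)) := hlmo.comp hM
      exact (hx k le_rfl).add (hl.const_smul (a / fourthRoot k ^ 3))

lemma IsStaleMethod.measurable_averagedNoise
    (h : IsStaleMethod (objective 𝒟 F) F lmo a s Z x₀ m₀ x M)
    (hF : UnbiasedBoundedVariance 𝒟 F σ) (hlmo : Measurable lmo) (k : ℕ) :
    Measurable[pastSamples Z k]
      fun ω => averagedNoise (updateNoise (objective 𝒟 F) F s Z x ω) k := by
  induction k with
  | zero => exact measurable_const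
  | succ k ih =>
    have hle : pastSamples Z k ≤ pastSamples Z (k + 1) := pastSamples_mono k.le_succ
    let _ : MeasurableSpace Ω := pastSamples Z (k + 1)
    have ih' : Measurable fun ω => averagedNoise (updateNoise (objective 𝒟 F) F s Z x ω) k :=
      ih.mono hle le_rfl
    have hν : Measurable fun ω => updateNoise (objective 𝒟 F) F s Z x ω k :=
      measurable_updateNoise hF (((h.measurable_past hF hlmo k).2 _ (h.le k)).mono hle le_rfl)
    exact (ih'.const_smul (1 - agnosticMomentum k)).add (hν.const_smul (agnosticMomentum k))

end Adapted

variable [mΩ : MeasurableSpace Ω] {P : Measure Ω}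
  {𝒟 : Measure Ξ} [IsProbabilityMeasure 𝒟] {F : Vec d → Ξ → ℝ} {σ : ℝ}
  {lmo : Vec d → Vec d} {a : ℝ} {s : ℕ → ℕ} {x₀ m₀ : Vec d} {x M : Ω → ℕ → Vec d}

lemma pastSamples_le (hZ : ∀ k, Measurable (Z k)) (k : ℕ) : pastSamples Z k ≤ mΩ :=
  iSup₂_le fun j _ => (hZ j).comap_le

/-- Samples are ordered by the update that consumes them, not by when their computation began. Since
`x (s k)` with `s k ≤ k` depends only on samples of index below `k`, sample `k` is fresh even for a
stale gradient. -/
lemma indep_pastSamples (hZ : ∀ k, Measurable (Z k)) (hind : iIndepFun Z P) (k : ℕ) :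
    Indep (pastSamples Z k) (MeasurableSpace.comap (Z k) inferInstance) P := by
  have h := indep_iSup_of_disjoint (m := fun j => MeasurableSpace.comap (Z j) inferInstance)
    (μ := P) (fun j => (hZ j).comap_le) hind (S := Set.Iio k) (T := {k}) (by simp)
  simpa [pastSamples] using h

/-- Here `t = (k + 1)^{-1/2}` and `t' = (k + 2)^{-1/2}`, which is what `htt` encodes. The
contraction `(1 - t) ^ 2` gains order `t ^ 2`, enough for the new variance `t ^ 2 S` and for the
decrease from `t` to `t' ≥ t (1 - t ^ 2 / 2)`. -/
lemma variance_recursion_le {t t' V W S : ℝ} (ht : 0 < t) (ht1 : t ≤ 1) (ht' : 0 < t')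
    (htt : t' ^ 2 * (1 + t ^ 2) = t ^ 2) (hS : 0 ≤ S) (hV : V ≤ 2 * S * t)
    (hW : W ≤ (1 - t) ^ 2 * V + t ^ 2 * S) : W ≤ 2 * S * t' := by
  have h1 : t * (1 - t ^ 2 / 2) ≤ t' := by
    by_contra! hcon
    have h2 : t' ^ 2 < (t * (1 - t ^ 2 / 2)) ^ 2 := by gcongr
    have h3 : (t * (1 - t ^ 2 / 2)) ^ 2 * (1 + t ^ 2) ≤ t ^ 2 := by
      have h4 : 0 ≤ t ^ 6 * (3 - t ^ 2) := by
        have : t ^ 2 ≤ 1 := by nlinarith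
        exact mul_nonneg (by positivity) (by linarith)
      nlinarith
    nlinarith [sq_nonneg t]
  have h5 : (1 - t) ^ 2 * V ≤ (1 - t) ^ 2 * (2 * S * t) := by gcongr
  have h6 : (1 - t) ^ 2 * (2 * t) + t ^ 2 ≤ 2 * (t * (1 - t ^ 2 / 2)) := by
    nlinarith [mul_nonneg (sq_nonneg t) (sub_nonneg.2 ht1)]
  have h7 : S * ((1 - t) ^ 2 * (2 * t) + t ^ 2) ≤ S * (2 * t') := by
    gcongr
    linarith
  nlinarith

variable [IsProbabilityMeasure P]

lemma sq_integral_le_integral_sq {X : Ω → ℝ} (hX : Integrable X P)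
    (hX2 : Integrable (fun ω => X ω ^ 2) P) : (∫ ω, X ω ∂P) ^ 2 ≤ ∫ ω, X ω ^ 2 ∂P := by
  set μ := ∫ ω, X ω ∂P with hμ
  have h0 : 0 ≤ ∫ ω, (X ω - μ) ^ 2 ∂P := integral_nonneg fun _ => sq_nonneg _
  have h1 : ∫ ω, (X ω - μ) ^ 2 ∂P = ∫ ω, X ω ^ 2 ∂P - μ ^ 2 := by
    have h2 : ∀ ω, (X ω - μ) ^ 2 = X ω ^ 2 - (2 * μ * X ω - μ ^ 2) := fun ω => by ring
    simp only [h2]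
    have h3 : Integrable (fun ω => 2 * μ * X ω - μ ^ 2) P :=
      (hX.const_mul _).sub (integrable_const _)
    rw [integral_sub hX2 h3,
      integral_sub (hX.const_mul _) (integrable_const _), integral_const_mul, ← hμ]
    simp
    ring
  linarith

/-- The cross term vanishes because the fresh noise is uncorrelated with the past average. This
needs an inner product, which is why the noise is measured in the Euclidean norm and `ρ` is paid
only at the end. -/
lemma IsStaleMethod.integral_averagedNoise_succ_le
    (h : IsStaleMethod (objective 𝒟 F) F lmo a s Z x₀ m₀ x M)
    (hF : UnbiasedBoundedVariance 𝒟 F σ) (hlmo : Measurable lmo)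
    (hZ : ∀ k, Measurable (Z k)) (hlaw : ∀ k, P.map (Z k) = 𝒟) (hind : iIndepFun Z P) (k : ℕ)
    (hint : Integrable
      (fun ω => ‖averagedNoise (updateNoise (objective 𝒟 F) F s Z x ω) k‖ ^ 2) P) :
    Integrable
      (fun ω => ‖averagedNoise (updateNoise (objective 𝒟 F) F s Z x ω) (k + 1)‖ ^ 2) P ∧
    ∫ ω, ‖averagedNoise (updateNoise (objective 𝒟 F) F s Z x ω) (k + 1)‖ ^ 2 ∂P ≤
      (1 - agnosticMomentum k) ^ 2 *
        ∫ ω, ‖averagedNoise (updateNoise (objective 𝒟 F) F s Z x ω) k‖ ^ 2 ∂P +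
      agnosticMomentum k ^ 2 * σ ^ 2 := by
  set u : Ω → Vec d := fun ω => averagedNoise (updateNoise (objective 𝒟 F) F s Z x ω) k with hu
  have hup : Measurable[pastSamples Z k] u := h.measurable_averagedNoise hF hlmo k
  have hzp : Measurable[pastSamples Z k] fun ω => x ω (s k) :=
    (h.measurable_past hF hlmo k).2 _ (h.le k)
  have hle := pastSamples_le hZ k
  have hYp : Measurable[pastSamples Z k] fun ω => (u ω, x ω (s k)) :=
    hup.prodMk hzp
  have hindep : IndepFun (fun ω => (u ω, x ω (s k))) (Z k) P :=
    indep_of_indep_of_le_left (indep_pastSamples hZ hind k) hYp.comap_le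
  obtain ⟨h1, h2, h3, h4⟩ := hF.fresh_noise (hup.mono hle le_rfl) (hzp.mono hle le_rfl) (hZ k)
    (hlaw k) hindep hint
  set α := agnosticMomentum k
  set ν : Ω → Vec d := fun ω => stochGrad F (x ω (s k)) (Z k ω) -
    gradient (objective 𝒟 F) (x ω (s k)) with hν
  have hexp : ∀ ω, ‖averagedNoise (updateNoise (objective 𝒟 F) F s Z x ω) (k + 1)‖ ^ 2 =
      (1 - α) ^ 2 * ‖u ω‖ ^ 2 + 2 * ((1 - α) * α) * inner ℝ (u ω) (ν ω) + α ^ 2 * ‖ν ω‖ ^ 2 := by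
    intro ω
    change ‖(1 - α) • u ω + α • ν ω‖ ^ 2 = _
    rw [norm_add_sq_real, norm_smul, norm_smul, inner_smul_left, inner_smul_right, mul_pow, mul_pow,
      Real.norm_eq_abs, Real.norm_eq_abs, sq_abs, sq_abs]
    simp
    ring
  have i1 : Integrable (fun ω => (1 - α) ^ 2 * ‖u ω‖ ^ 2) P := hint.const_mul _
  have i2 : Integrable (fun ω => 2 * ((1 - α) * α) * (inner ℝ (u ω) (ν ω) : ℝ)) P :=
    h3.const_mul _
  have i3 : Integrable (fun ω => α ^ 2 * ‖ν ω‖ ^ 2) P := h1.const_mul _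
  have i12 : Integrable (fun ω => (1 - α) ^ 2 * ‖u ω‖ ^ 2 +
      2 * ((1 - α) * α) * (inner ℝ (u ω) (ν ω) : ℝ)) P := i1.add i2
  simp only [hexp]
  refine ⟨i12.add i3, ?_⟩
  rw [integral_add i12 i3, integral_add i1 i2, integral_const_mul, integral_const_mul,
    integral_const_mul, h4]
  have : α ^ 2 * ∫ ω, ‖ν ω‖ ^ 2 ∂P ≤ α ^ 2 * σ ^ 2 := by gcongr
  linarith

lemma IsStaleMethod.integral_averagedNoise_le
    (h : IsStaleMethod (objective 𝒟 F) F lmo a s Z x₀ m₀ x M)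
    (hF : UnbiasedBoundedVariance 𝒟 F σ) (hlmo : Measurable lmo)
    (hZ : ∀ k, Measurable (Z k)) (hlaw : ∀ k, P.map (Z k) = 𝒟) (hind : iIndepFun Z P) (k : ℕ) :
    Integrable
      (fun ω => ‖averagedNoise (updateNoise (objective 𝒟 F) F s Z x ω) (k + 1)‖ ^ 2) P ∧
    ∫ ω, ‖averagedNoise (updateNoise (objective 𝒟 F) F s Z x ω) (k + 1)‖ ^ 2 ∂P ≤
      2 * σ ^ 2 * (1 / fourthRoot k ^ 2) := by
  have hstep := h.integral_averagedNoise_succ_le hF hlmo hZ hlaw hind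
  induction k with
  | zero =>
    obtain ⟨h1, h2⟩ := hstep 0 (by simp [averagedNoise])
    refine ⟨h1, h2.trans ?_⟩
    simp only [agnosticMomentum_zero, fourthRoot]
    simp
    nlinarith [sq_nonneg σ]
  | succ k ih =>
    obtain ⟨h1, h2⟩ := hstep (k + 1) ih.1
    have hq := fourthRoot_pos k
    have hq' := fourthRoot_pos (k + 1)
    refine ⟨h1, variance_recursion_le (t := 1 / fourthRoot k ^ 2) (by positivity) ?_
      (by positivity) ?_ (sq_nonneg σ) ih.2 ?_⟩
    · rw [← agnosticMomentum_succ]; exact agnosticMomentum_le_one _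
    · have h3 := fourthRoot_pow_four k
      have h4 := fourthRoot_pow_four (k + 1)
      push_cast at h4
      rw [div_pow, div_pow, ← pow_mul, ← pow_mul]
      norm_num
      rw [h3, h4]
      have : (0 : ℝ) < k + 1 := by positivity
      field_simp
    · rw [← agnosticMomentum_succ]
      exact h2

lemma IsStaleMethod.integral_dualNorm_averagedNoise_le {N : Seminorm ℝ (Vec d)} (hN : IsNormOn N)
    (h : IsStaleMethod (objective 𝒟 F) F lmo a s Z x₀ m₀ x M)
    (hF : UnbiasedBoundedVariance 𝒟 F σ) (hlmo : Measurable lmo)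
    (hZ : ∀ k, Measurable (Z k)) (hlaw : ∀ k, P.map (Z k) = 𝒟) (hind : iIndepFun Z P) (k : ℕ) :
    Integrable (fun ω =>
      dualNorm N (averagedNoise (updateNoise (objective 𝒟 F) F s Z x ω) (k + 1))) P ∧
    ∫ ω, dualNorm N (averagedNoise (updateNoise (objective 𝒟 F) F s Z x ω) (k + 1)) ∂P ≤
      3 / 2 * (normEquivConst N * σ) / fourthRoot k := by
  obtain ⟨h1, h2⟩ := h.integral_averagedNoise_le hF hlmo hZ hlaw hind k
  set u : Ω → Vec d :=
    fun ω => averagedNoise (updateNoise (objective 𝒟 F) F s Z x ω) (k + 1) with hu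
  have hum : Measurable u :=
    (h.measurable_averagedNoise hF hlmo (k + 1)).mono (pastSamples_le hZ _) le_rfl
  have hnorm : Integrable (fun ω => ‖u ω‖) P := by
    refine (h1.add (integrable_const (1 : ℝ))).mono' hum.norm.aestronglyMeasurable
      (Filter.Eventually.of_forall fun ω => ?_)
    simp only [Pi.add_apply, norm_norm]
    nlinarith [sq_nonneg (‖u ω‖ - 1 / 2)]
  have hdom := hnorm.const_mul (normEquivConst N)
  have hint : Integrable (fun ω => dualNorm N (u ω)) P := by
    refine hdom.mono' ((dualNorm_continuous hN).measurable.comp hum).aestronglyMeasurable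
      (Filter.Eventually.of_forall fun ω => ?_)
    rw [Real.norm_of_nonneg (dualNorm_nonneg hN _)]
    exact dualNorm_le_normEquivConst_mul hN _
  refine ⟨hint, ?_⟩
  have hq := fourthRoot_pos k
  have hσ := hF.sigma_nonneg
  -- Jensen's inequality; `3/2` is a rational bound for `√2`.
  have h3 : ∫ ω, ‖u ω‖ ∂P ≤ 3 / 2 * σ / fourthRoot k := by
    refine abs_le_of_sq_le_sq' ?_ (by positivity) |>.2
    refine (sq_integral_le_integral_sq hnorm h1).trans (h2.trans ?_)
    rw [div_pow, mul_one_div]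
    gcongr
    nlinarith [sq_nonneg σ]
  calc ∫ ω, dualNorm N (u ω) ∂P ≤ ∫ ω, normEquivConst N * ‖u ω‖ ∂P :=
        integral_mono hint hdom fun ω => dualNorm_le_normEquivConst_mul hN _
    _ = normEquivConst N * ∫ ω, ‖u ω‖ ∂P := integral_const_mul _ _
    _ ≤ normEquivConst N * (3 / 2 * σ / fourthRoot k) := by
        have := normEquivConst_nonneg hN
        gcongr
    _ = _ := by ring

theorem IsStaleMethod.sum_integral_dualNorm_gradient_le {N : Seminorm ℝ (Vec d)}
    {L₀ L₁ fstar : ℝ} (hN : IsNormOn N)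
    (h : IsStaleMethod (objective 𝒟 F) F lmo a s Z x₀ m₀ x M) (ha : 0 ≤ a)
    (hF : UnbiasedBoundedVariance 𝒟 F σ) (hlmo : IsLMO N lmo)
    (hf : GenSmooth N (objective 𝒟 F) L₀ L₁) (hstar : ∀ y, fstar ≤ objective 𝒟 F y)
    (hZ : ∀ k, Measurable (Z k)) (hlaw : ∀ k, P.map (Z k) = 𝒟) (hind : iIndepFun Z P) :
    (∀ k, Integrable (fun ω => dualNorm N (gradient (objective 𝒟 F) (x ω k))) P) ∧
    ∀ K, ∑ k ∈ Finset.range K, a / fourthRoot k ^ 3 *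
        ∫ ω, dualNorm N (gradient (objective 𝒟 F) (x ω k)) ∂P ≤
      2 * (objective 𝒟 F x₀ - fstar) + a * (6 * (normEquivConst N * σ) +
        2 * (9 * a * L₀ * Real.exp (2 * (L₁ * a)) +
        9 * (L₁ * a) * Real.exp (2 * (L₁ * a)) * Real.exp (144 * (L₁ * a) ^ 2) *
          (dualNorm N (gradient (objective 𝒟 F) x₀) + 144 * L₀ * a * (L₁ * a)))) *
        ∑ k ∈ Finset.range K, 1 / fourthRoot k ^ 4 := by
  have hG : ∀ k, Integrable (fun ω => dualNorm N (gradient (objective 𝒟 F) (x ω k))) P := by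
    intro k
    have hxm : Measurable fun ω => x ω k :=
      ((h.measurable_past hF hlmo.measurable k).2 k le_rfl).mono (pastSamples_le hZ _) le_rfl
    -- Steps have bounded length whatever the samples are, so the gradient norm at index `k` has a
    -- deterministic bound.
    refine Integrable.of_bound (C := Real.exp (L₁ * (4 * a * fourthRoot k)) *
        (dualNorm N (gradient (objective 𝒟 F) x₀) + L₀ * (4 * a * fourthRoot k)))
      ((dualNorm_continuous hN).measurable.comp
        ((measurable_gradient _).comp hxm)).aestronglyMeasurable
      (Filter.Eventually.of_forall fun ω => ?_)
    rw [Real.norm_of_nonneg (dualNorm_nonneg hN _), ← h.x_zero ω]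
    exact hf.dualNorm_gradient_le hN _ _ ((h.trajectory ω).seminorm_sub_zero_le ha hlmo k)
  refine ⟨hG, fun K => ?_⟩
  have hnoise := h.integral_dualNorm_averagedNoise_le (P := P) hN hF hlmo.measurable hZ hlaw hind
  set Q := 9 * a * L₀ * Real.exp (2 * (L₁ * a)) +
        9 * (L₁ * a) * Real.exp (2 * (L₁ * a)) * Real.exp (144 * (L₁ * a) ^ 2) *
          (dualNorm N (gradient (objective 𝒟 F) x₀) + 144 * L₀ * a * (L₁ * a)) with hQ
  set H := ∑ k ∈ Finset.range K, 1 / fourthRoot k ^ 4 with hH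
  have hpath : ∀ ω, ∑ k ∈ Finset.range K, a / fourthRoot k ^ 3 *
        dualNorm N (gradient (objective 𝒟 F) (x ω k)) ≤
      2 * (objective 𝒟 F x₀ - fstar) + 2 * a * Q * H + 4 * ∑ k ∈ Finset.range K,
        a / fourthRoot k ^ 3 *
          dualNorm N (averagedNoise (updateNoise (objective 𝒟 F) F s Z x ω) (k + 1)) := by
    intro ω
    have := (h.trajectory ω).sum_dualNorm_gradient_le ha hN hlmo hf hF.differentiable_objective
      hstar K
    rw [h.x_zero ω] at this
    linarith
  have hGi := fun k (_ : k ∈ Finset.range K) => (hG k).const_mul (a / fourthRoot k ^ 3)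
  have hni := fun k (_ : k ∈ Finset.range K) => (hnoise k).1.const_mul (a / fourthRoot k ^ 3)
  have hni4 := (integrable_finsetSum _ hni).const_mul 4
  have hrhs : Integrable (fun ω => 2 * (objective 𝒟 F x₀ - fstar) + 2 * a * Q * H +
      4 * ∑ k ∈ Finset.range K, a / fourthRoot k ^ 3 *
        dualNorm N (averagedNoise (updateNoise (objective 𝒟 F) F s Z x ω) (k + 1))) P :=
    (integrable_const _).add hni4
  have hmono := integral_mono (integrable_finsetSum _ hGi) hrhs hpath
  rw [integral_finsetSum _ hGi, integral_add (integrable_const _) hni4, integral_const_mul,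
    integral_finsetSum _ hni] at hmono
  simp only [integral_const_mul, integral_const, probReal_univ, one_smul] at hmono
  have hsum : ∑ k ∈ Finset.range K, a / fourthRoot k ^ 3 *
      ∫ ω, dualNorm N (averagedNoise (updateNoise (objective 𝒟 F) F s Z x ω) (k + 1)) ∂P ≤
      3 / 2 * (normEquivConst N * σ) * a * H := by
    rw [hH, Finset.mul_sum]
    refine Finset.sum_le_sum fun k _ => ?_
    have hq := fourthRoot_pos k
    calc _ ≤ a / fourthRoot k ^ 3 * (3 / 2 * (normEquivConst N * σ) / fourthRoot k) := by
          gcongr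
          exact (hnoise k).2
      _ = _ := by field_simp
  linarith

end AveragedNoise

/-! ### From the averaged bound to the complexity -/

section Complexity

lemma sum_inv_fourthRoot_pow_four_le (K : ℕ) :
    ∑ k ∈ Finset.range (K + 1), 1 / fourthRoot k ^ 4 ≤ 1 + 4 * Real.log (fourthRoot K) := by
  have h1 := harmonic_le_one_add_log (K + 1)
  have h2 : 4 * Real.log (fourthRoot K) = Real.log ((K + 1 : ℕ) : ℝ) := by
    have := fourthRoot_pow_four K
    push_cast
    rw [← this, Real.log_pow]
    norm_num
  rw [h2]
  refine le_trans (le_of_eq ?_) h1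
  simp [harmonic, fourthRoot_pow_four]

lemma fourthRoot_le_sum (K : ℕ) :
    fourthRoot K ≤ ∑ k ∈ Finset.range (K + 1), 1 / fourthRoot k ^ 3 := by
  have hK := fourthRoot_pos K
  have h1 : ∀ k ∈ Finset.range (K + 1), 1 / fourthRoot K ^ 3 ≤ 1 / fourthRoot k ^ 3 := by
    intro k hk
    have h2 := fourthRoot_pos k
    have h3 : fourthRoot k ≤ fourthRoot K :=
      fourthRoot_mono (Nat.lt_succ_iff.1 (Finset.mem_range.1 hk))
    gcongr
  refine le_trans (le_of_eq ?_) (Finset.card_nsmul_le_sum _ _ _ h1)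
  rw [Finset.card_range, nsmul_eq_mul]
  push_cast
  rw [← fourthRoot_pow_four]
  field_simp

lemma log_le_two_mul_sqrt {y : ℝ} (hy : 0 < y) : Real.log y ≤ 2 * √y := by
  have h1 : Real.log y = 2 * Real.log (√y) := by
    rw [Real.log_sqrt hy.le]; ring
  have h2 := Real.log_le_sub_one_of_pos (Real.sqrt_pos.2 hy)
  linarith

/-- Inverting `y ≤ C z (1 + 4 log y)`. -/
lemma exists_le_mul_log {C : ℝ} (hC : 1 ≤ C) : ∃ C' : ℝ, 1 ≤ C' ∧ ∀ z y : ℝ, 0 ≤ z → 1 ≤ y →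
    y ≤ C * z * (1 + 4 * Real.log y) → y ≤ C' * (z * (1 + Real.log (1 + z))) := by
  have hlog : 0 ≤ Real.log (81 * C ^ 2) := Real.log_nonneg (by nlinarith)
  refine ⟨C * (8 + 4 * Real.log (81 * C ^ 2)), by nlinarith, fun z y hz hy h => ?_⟩
  have hy0 : 0 < y := one_pos.trans_le hy
  have hs : 1 ≤ √y := Real.one_le_sqrt.2 hy
  have hsq := Real.sq_sqrt hy0.le
  have hB : 0 ≤ C * z := by positivity
  -- Bootstrap: the crude bound `log y ≤ 2 √y` makes `y` at most quadratic in `1 + z`. This bounds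
  -- `log y` by a constant plus `2 log (1 + z)`, which is reinserted in the hypothesis.
  have h1 : y ≤ C * z * (9 * √y) := by
    refine h.trans ?_
    have := log_le_two_mul_sqrt hy0
    gcongr
    linarith
  have h2 : √y ≤ 9 * (C * z) := by
    have : √y * √y ≤ 9 * (C * z) * √y := by nlinarith
    exact le_of_mul_le_mul_right this (by linarith)
  have h3 : y ≤ 81 * C ^ 2 * (1 + z) ^ 2 := by
    calc y = √y ^ 2 := hsq.symm
      _ ≤ (9 * (C * z)) ^ 2 := by gcongr
      _ = 81 * C ^ 2 * z ^ 2 := by ring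
      _ ≤ _ := by gcongr; linarith
  have h4 : Real.log y ≤ Real.log (81 * C ^ 2) + 2 * Real.log (1 + z) := by
    refine (Real.log_le_log hy0 h3).trans (le_of_eq ?_)
    rw [Real.log_mul (by positivity) (by positivity), Real.log_pow]
    norm_num
  have h5 : 0 ≤ Real.log (1 + z) := Real.log_nonneg (by linarith)
  calc y ≤ C * z * (1 + 4 * Real.log y) := h
    _ ≤ C * z * ((8 + 4 * Real.log (81 * C ^ 2)) * (1 + Real.log (1 + z))) := by
        gcongr
        nlinarith [mul_nonneg hlog h5]
    _ = _ := by ring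

/-- Everything is collected in the three terms of the envelope. Polynomial factors in `A` and
`e^{2A}` are absorbed by `w = e^{A^2}`, and the total exponent 146 stays below `289 = 17 ^ 2`, the
value for which the stepsize constant `η / 17` turns `289 (L₁ c) ^ 2` into `L₁ ^ 2 η ^ 2`. -/
lemma error_constant_le {Δ a L₀ A G S : ℝ} (hΔ : 0 ≤ Δ) (ha : 0 < a) (hL₀ : 0 ≤ L₀) (hA : 0 ≤ A)
    (hS : 0 ≤ S) (hG : G ≤ 2 * (1 + 4 * A) * (Δ / a) + 4 * L₀ * a) :
    2 * (Δ / a) + 6 * S + 2 * (9 * a * L₀ * Real.exp (2 * A) +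
        9 * A * Real.exp (2 * A) * Real.exp (144 * A ^ 2) * (G + 144 * L₀ * a * A)) ≤
      9000 * (Real.exp (289 * A ^ 2) * (Δ / a) + S + Real.exp (289 * A ^ 2) * L₀ * a) := by
  set w := Real.exp (A ^ 2) with hw
  have hw1 : A ^ 2 + 1 ≤ w := Real.add_one_le_exp _
  have hw0 : 1 ≤ w := by nlinarith [sq_nonneg A]
  have h2A : Real.exp (2 * A) ≤ 3 * w := by
    calc Real.exp (2 * A) ≤ Real.exp (1 + A ^ 2) :=
          Real.exp_le_exp.2 (by nlinarith [sq_nonneg (A - 1)])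
      _ = Real.exp 1 * w := Real.exp_add _ _
      _ ≤ _ := by
        have := Real.exp_one_lt_d9
        gcongr
        linarith
  have hAw : A ≤ w := by nlinarith [sq_nonneg (A - 1)]
  have hA2w : A ^ 2 ≤ w := by linarith
  have hD : 0 ≤ Δ / a := by positivity
  have hL : 0 ≤ L₀ * a := by positivity
  set V := Real.exp (144 * A ^ 2) with hV
  set E := Real.exp (289 * A ^ 2) with hE
  have hV0 : 0 < V := Real.exp_pos _
  have hwE : w ≤ E := Real.exp_le_exp.2 (by nlinarith [sq_nonneg A])
  have hE1 : 1 ≤ E := hw0.trans hwE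
  have hVE : V * w * w ≤ E := by
    rw [hV, hw, hE, ← Real.exp_add, ← Real.exp_add]
    exact Real.exp_le_exp.2 (by nlinarith [sq_nonneg A])
  set D := Δ / a with hDdef
  have t1 : 9 * a * L₀ * Real.exp (2 * A) ≤ 27 * (E * (L₀ * a)) := by
    calc 9 * a * L₀ * Real.exp (2 * A) ≤ 9 * a * L₀ * (3 * w) := by gcongr
      _ = 27 * (w * (L₀ * a)) := by ring
      _ ≤ _ := by gcongr
  have t2 : 9 * A * Real.exp (2 * A) * V * (G + 144 * L₀ * a * A) ≤
      9 * A * (3 * w) * V * (2 * (1 + 4 * A) * D + 4 * L₀ * a + 144 * L₀ * a * A) := by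
    have h0 : 0 ≤ 2 * (1 + 4 * A) * D + 4 * L₀ * a + 144 * L₀ * a * A := by positivity
    calc _ ≤ 9 * A * Real.exp (2 * A) * V *
          (2 * (1 + 4 * A) * D + 4 * L₀ * a + 144 * L₀ * a * A) := by gcongr
      _ ≤ _ := by gcongr
  have t3 : 9 * A * (3 * w) * V *
      (2 * (1 + 4 * A) * D + 4 * L₀ * a + 144 * L₀ * a * A) ≤
      270 * (E * D) + 3996 * (E * (L₀ * a)) := by
    calc _ = V * w * ((54 * A + 216 * A ^ 2) * D + (108 * A + 3888 * A ^ 2) * (L₀ * a)) := by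
          ring
      _ ≤ V * w * ((54 * w + 216 * w) * D + (108 * w + 3888 * w) * (L₀ * a)) := by gcongr
      _ = V * w * w * (270 * D + 3996 * (L₀ * a)) := by ring
      _ ≤ E * (270 * D + 3996 * (L₀ * a)) := by gcongr
      _ = _ := by ring
  have t4 : D ≤ E * D := le_mul_of_one_le_left hD hE1
  have t5 : 0 ≤ E * D := by positivity
  have t6 : 0 ≤ E * (L₀ * a) := by positivity
  rw [mul_assoc E L₀ a]
  linarith

/-- The factor `51 = 3 · 17` is set by the case of known `L₁`: the exponent is then exactly `1`, `e
≤ 3`, and dividing by `c` yields `17 L₁`. The other cases leave room. -/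
lemma AgnosticChoice.envelope_le {L₀ L₁ Δ S c Ψ : ℝ} (h : AgnosticChoice L₀ L₁ Δ S c Ψ)
    (hΔ : 0 ≤ Δ) (hS : 0 ≤ S) (hL₀ : 0 ≤ L₀) : 0 < c ∧ 0 ≤ Ψ ∧
      Real.exp (289 * (L₁ * c) ^ 2) * (Δ / c) + S + Real.exp (289 * (L₁ * c) ^ 2) * L₀ * c ≤
        51 * Ψ := by
  rcases h with ⟨rfl, η, hη, rfl, rfl⟩ | ⟨hL₁, η, hη, rfl, rfl⟩ | ⟨hL₁, rfl, rfl⟩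
  · have h0 : 0 ≤ envelope L₀ 0 Δ S c := by unfold envelope; positivity
    refine ⟨hη, h0, le_trans (le_of_eq ?_) (by linarith : envelope L₀ 0 Δ S c ≤ _)⟩
    simp [envelope]
  · have h0 : 0 ≤ envelope L₀ L₁ Δ S η := by unfold envelope; positivity
    refine ⟨by positivity, h0, le_trans ?_ (by linarith : 17 * envelope L₀ L₁ Δ S η ≤ _)⟩
    have h1 : 289 * (L₁ * (η / 17)) ^ 2 = L₁ ^ 2 * η ^ 2 := by ring
    rw [h1, envelope]
    set E := Real.exp (L₁ ^ 2 * η ^ 2)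
    have h2 : E * (Δ / (η / 17)) = 17 * (E * (Δ / η)) := by field_simp
    have h3 : E * L₀ * (η / 17) = (E * L₀ * η) / 17 := by ring
    have h4 : 0 ≤ E * L₀ * η := by positivity
    rw [h2, h3]
    linarith
  · have h0 : 0 ≤ L₁ * Δ + S + L₀ / L₁ := by positivity
    refine ⟨by positivity, h0, ?_⟩
    have h1 : 289 * (L₁ * (1 / (17 * L₁))) ^ 2 = 1 := by field_simp; norm_num
    have h2 : Δ / (1 / (17 * L₁)) = 17 * (L₁ * Δ) := by field_simp
    have h3 : Real.exp 1 * L₀ * (1 / (17 * L₁)) = Real.exp 1 / 17 * (L₀ / L₁) := by field_simp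
    rw [h1, h2, h3]
    have he : Real.exp 1 ≤ 3 := by linarith [Real.exp_one_lt_d9]
    have h4 : 0 ≤ L₁ * Δ := by positivity
    have h5 : 0 ≤ L₀ / L₁ := by positivity
    have h6 : Real.exp 1 * (17 * (L₁ * Δ)) ≤ 3 * (17 * (L₁ * Δ)) := by gcongr
    have h7 : Real.exp 1 / 17 * (L₀ / L₁) ≤ 3 / 17 * (L₀ / L₁) := by gcongr
    linarith

variable {d : ℕ} {Ξ Ω : Type*} [MeasurableSpace Ξ] {𝒟 : Measure Ξ} [IsProbabilityMeasure 𝒟]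
  [MeasurableSpace Ω] {P : Measure Ω} [IsProbabilityMeasure P] {N : Seminorm ℝ (Vec d)}
  {lmo : Vec d → Vec d} {F : Vec d → Ξ → ℝ} {fstar σ L₀ L₁ c Ψ : ℝ} {s : ℕ → ℕ}
  {Z : ℕ → Ω → Ξ} {x₀ m₀ : Vec d} {x M : Ω → ℕ → Vec d}

/-- As long as no iterate is `ε`-stationary, the number of updates is bounded. -/
theorem IsStaleMethod.fourthRoot_le
    (h : IsStaleMethod (objective 𝒟 F) F lmo c s Z x₀ m₀ x M) (hN : IsNormOn N)
    (hF : UnbiasedBoundedVariance 𝒟 F σ) (hlmo : IsLMO N lmo)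
    (hf : GenSmooth N (objective 𝒟 F) L₀ L₁) (hstar : ∀ y, fstar ≤ objective 𝒟 F y)
    (hc : AgnosticChoice L₀ L₁ (objective 𝒟 F x₀ - fstar) (normEquivConst N * σ) c Ψ)
    (hZ : ∀ k, Measurable (Z k)) (hlaw : ∀ k, P.map (Z k) = 𝒟) (hind : iIndepFun Z P)
    {ε : ℝ} (hε : 0 < ε) {K : ℕ}
    (hK : ∀ k ≤ K, ε < ∫ ω, dualNorm N (gradient (objective 𝒟 F) (x ω k)) ∂P) :
    fourthRoot K ≤ 459000 * (Ψ / ε) * (1 + 4 * Real.log (fourthRoot K)) := by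
  have hΔ : 0 ≤ objective 𝒟 F x₀ - fstar := sub_nonneg.2 (hstar x₀)
  have hS : 0 ≤ normEquivConst N * σ := mul_nonneg (normEquivConst_nonneg hN) hF.sigma_nonneg
  obtain ⟨hc0, hΨ, hΨle⟩ := hc.envelope_le hΔ hS hf.L₀_nonneg
  have hA : 0 ≤ L₁ * c := mul_nonneg hf.L₁_nonneg hc0.le
  set A := L₁ * c with hAdef
  set Δ := objective 𝒟 F x₀ - fstar
  set S := normEquivConst N * σ
  set G := dualNorm N (gradient (objective 𝒟 F) x₀) with hGdef
  have hG : G ≤ 2 * (1 + 4 * A) * (Δ / c) + 4 * L₀ * c := by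
    -- The radius `c / (1 + 4 A)` satisfies `L₁ r ≤ 1/4` and is comparable to `c` when `A` is small.
    have h1 := hf.dualNorm_gradient_le_gap hN hF.differentiable_objective hlmo hstar x₀
      (r := c / (1 + 4 * A)) (by positivity) (by
        rw [mul_div_assoc', ← hAdef, div_le_iff₀ (by positivity)]; linarith)
    have h2 : c / (1 + 4 * A) ≤ c := div_le_self hc0.le (by linarith)
    have h3 : 4 * L₀ * (c / (1 + 4 * A)) ≤ 4 * L₀ * c := by
      have := hf.L₀_nonneg
      gcongr
    have h4 : 2 * Δ / (c / (1 + 4 * A)) = 2 * (1 + 4 * A) * (Δ / c) := by field_simp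
    rw [← hGdef, h4] at h1
    linarith
  have hconst := error_constant_le hΔ hc0 hf.L₀_nonneg hA hS hG
  have hsum := (h.sum_integral_dualNorm_gradient_le (P := P) hN hc0.le hF hlmo hf hstar hZ hlaw
    hind).2 (K + 1)
  set Q := 9 * c * L₀ * Real.exp (2 * A) + 9 * A * Real.exp (2 * A) *
    Real.exp (144 * A ^ 2) * (G + 144 * L₀ * c * A) with hQ
  have hlow : c * ε * fourthRoot K ≤ ∑ k ∈ Finset.range (K + 1), c / fourthRoot k ^ 3 *
      ∫ ω, dualNorm N (gradient (objective 𝒟 F) (x ω k)) ∂P := by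
    calc c * ε * fourthRoot K ≤ c * ε * ∑ k ∈ Finset.range (K + 1), 1 / fourthRoot k ^ 3 := by
          gcongr; exact fourthRoot_le_sum K
      _ = ∑ k ∈ Finset.range (K + 1), c / fourthRoot k ^ 3 * ε := by
          rw [Finset.mul_sum]
          exact Finset.sum_congr rfl fun k _ => by ring
      _ ≤ _ := by
          refine Finset.sum_le_sum fun k hk => ?_
          have := fourthRoot_pos k
          have := (hK k (Nat.lt_succ_iff.1 (Finset.mem_range.1 hk))).le
          gcongr
  have hℓ : 0 ≤ Real.log (fourthRoot K) := Real.log_nonneg (one_le_fourthRoot K)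
  have hG0 : 0 ≤ G := dualNorm_nonneg hN _
  have hL₀ := hf.L₀_nonneg
  have hQ0 : 0 ≤ Q := by positivity
  set ℓ := 1 + 4 * Real.log (fourthRoot K) with hℓdef
  -- The harmonic sum is at most `ℓ`, and `ℓ ≥ 1` lets the initial gap be multiplied by it too. The
  -- constant is `459000 = 9000 · 51`.
  have h1 : c * ε * fourthRoot K ≤ c * (459000 * Ψ * ℓ) := by
    calc c * ε * fourthRoot K ≤ 2 * Δ + c * (6 * S + 2 * Q) *
          ∑ k ∈ Finset.range (K + 1), 1 / fourthRoot k ^ 4 := hlow.trans hsum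
      _ ≤ 2 * Δ * ℓ + c * (6 * S + 2 * Q) * ℓ := by
          have := sum_inv_fourthRoot_pow_four_le K
          have h3 : 2 * Δ ≤ 2 * Δ * ℓ := le_mul_of_one_le_right (by positivity) (by linarith)
          gcongr
      _ = c * ((2 * (Δ / c) + 6 * S + 2 * Q) * ℓ) := by
          field_simp
          ring
      _ ≤ c * (459000 * Ψ * ℓ) := by
          have hℓ0 : 0 ≤ ℓ := by positivity
          gcongr
          linarith
  rw [mul_assoc] at h1
  have h2 := le_of_mul_le_mul_left h1 hc0
  calc fourthRoot K = ε * fourthRoot K / ε := by field_simp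
    _ ≤ 459000 * Ψ * ℓ / ε := by gcongr
    _ = _ := by ring

end Complexity

/-! ### Assembly: from the number of updates to the time -/

lemma iteration_bound_le {H y Y m C z ℓ : ℝ} (hH : 0 ≤ H) (hy : 1 ≤ y) (hyY : y ≤ Y)
    (hY : Y = C * (z * ℓ)) (hC : 1 ≤ C) (hm : 0 < m) :
    H * (y ^ 4 / m + 1 + 2 * y ^ 2) ≤ 3 * C ^ 4 * (H * (z ^ 2 * ℓ ^ 2 + z ^ 4 / m * ℓ ^ 4)) := by
  have h1 : y ^ 4 ≤ Y ^ 4 := by gcongr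
  have h2 : y ^ 2 ≤ Y ^ 2 := by gcongr
  have h3 : 1 ≤ y ^ 2 := one_le_pow₀ hy
  have h4 : C ^ 2 ≤ C ^ 4 := pow_le_pow_right₀ hC (by norm_num)
  calc H * (y ^ 4 / m + 1 + 2 * y ^ 2) ≤ H * (3 * (Y ^ 4 / m) + 3 * Y ^ 2) := by
        have h5 : y ^ 4 / m ≤ Y ^ 4 / m := by gcongr
        have h6 : 0 ≤ Y ^ 4 / m := by positivity
        gcongr ?_ * ?_
        linarith
    _ = 3 * (H * (C ^ 2 * (z ^ 2 * ℓ ^ 2) + C ^ 4 * (z ^ 4 / m * ℓ ^ 4))) := by rw [hY]; ring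
    _ ≤ 3 * (H * (C ^ 4 * (z ^ 2 * ℓ ^ 2) + C ^ 4 * (z ^ 4 / m * ℓ ^ 4))) := by gcongr
    _ = _ := by ring

theorem theorem4 :
    ∃ C : ℝ, 0 < C ∧
      ∀ (d n : ℕ) (Ξ : Type*) [MeasurableSpace Ξ] (𝒟 : Measure Ξ) [IsProbabilityMeasure 𝒟]
        (Ω : Type*) [MeasurableSpace Ω] (P : Measure Ω) [IsProbabilityMeasure P]
        (N : Seminorm ℝ (Vec d)) (_ : IsNormOn N)
        (lmo : Vec d → Vec d) (_ : IsLMO N lmo)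
        (F : Vec d → Ξ → ℝ) (fstar σ L₀ L₁ : ℝ)
        (_ : ∀ x, fstar ≤ objective 𝒟 F x)
        (_ : UnbiasedBoundedVariance 𝒟 F σ)
        (_ : GenSmooth N (objective 𝒟 F) L₀ L₁)
        (x₀ m₀ : Vec d) (c Ψ : ℝ)
        (_ : AgnosticChoice L₀ L₁ (objective 𝒟 F x₀ - fstar) (normEquivConst N * σ) c Ψ)
        (τ : Fin n → ℝ) (_ : ∀ i, 0 < τ i) (_ : Monotone τ)
        (w : ℕ → Fin n) (_ : IsArrivalOrder τ (agnosticParams c).R w)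
        (ξ : Fin n → ℕ → Ω → Ξ) (_ : IsIIDSampling 𝒟 P ξ)
        (ε : ℝ) (_ : 0 < ε),
        ∃ (K : ℕ) (T : ℝ),
          IsIterationComplexity N 𝒟 P (agnosticParams c) lmo F x₀ m₀ τ w ξ ε K ∧
          IsCompletionTime τ (agnosticParams c).R w K T ∧
          T ≤ C * ⨅ m : Fin n, harmonicMean τ m *
            (Ψ ^ 2 / ε ^ 2 * (1 + Real.log (1 + Ψ / ε)) ^ 2 +
              Ψ ^ 4 / (((m : ℕ) + 1 : ℝ) * ε ^ 4) * (1 + Real.log (1 + Ψ / ε)) ^ 4) := by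
  obtain ⟨C, hC, hinv⟩ := exists_le_mul_log (C := 459000) (by norm_num)
  refine ⟨3 * C ^ 4, by positivity, ?_⟩
  intro d n Ξ _ 𝒟 _ Ω _ P _ N hN lmo hlmo F fstar σ L₀ L₁ hstar hF hf x₀ m₀ c Ψ hc τ hτ _ w hw
    ξ hξ ε hε
  set p := agnosticParams c with hp
  have hR1 : ∀ k, 1 ≤ p.R k := one_le_agnosticParams_R c
  have hR : ∀ k : ℕ, √(k : ℝ) ≤ p.R k := sqrt_le_agnosticParams_R c
  obtain ⟨q, s, X, M, hs, hdel, hinj, hX0, hM0, hMs, hXs, hrun⟩ :=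
    exists_update_recursion p lmo F x₀ m₀ hτ hR1 hR w
  set Z : ℕ → Ω → Ξ := fun k => ξ (q k) (s k) with hZdef
  have hmethod : IsStaleMethod (objective 𝒟 F) F lmo c s Z x₀ m₀
      (fun ω => X fun i k => ξ i k ω) (fun ω => M fun i k => ξ i k ω) := by
    refine ⟨hs, fun ω => hX0 _, fun ω => hM0 _, fun ω => ⟨hs, fun k => ?_, fun k => ?_, fun k => ?_⟩⟩
    · have h1 := hdel (k + 1)
      rw [hp, agnosticParams_R, if_neg k.succ_ne_zero, sqrt_succ_eq] at h1
      exact_mod_cast h1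
    · rw [hMs, AlgParams.momentum, updateNoise, add_sub_cancel]
      split_ifs with hk
      · subst hk
        simp [hp, agnosticParams, agnosticMomentum_zero, hZdef]
      · rfl
    · rw [hXs, hp, agnosticParams_η]
  have hZ : ∀ k, Measurable (Z k) := fun k => hξ.measurable _ _
  have hlaw : ∀ k, P.map (Z k) = 𝒟 := fun k => hξ.law _ _
  have hind : iIndepFun Z P := hξ.indep.precomp hinj
  have hS : 0 ≤ normEquivConst N * σ := mul_nonneg (normEquivConst_nonneg hN) hF.sigma_nonneg
  obtain ⟨hc0, hΨ, -⟩ := hc.envelope_le (sub_nonneg.2 (hstar x₀)) hS hf.L₀_nonneg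
  have hint := (hmethod.sum_integral_dualNorm_gradient_le (P := P) hN hc0.le hF hlmo hf hstar hZ
    hlaw hind).1
  set g : ℕ → ℝ := fun k =>
    ∫ ω, dualNorm N (gradient (objective 𝒟 F) (X (fun i k => ξ i k ω) k)) ∂P with hg
  set z := Ψ / ε with hz
  have hz0 : 0 ≤ z := by positivity
  set ℓ := 1 + Real.log (1 + z) with hℓ
  have hbound : ∀ K, (∀ k ≤ K, ε < g k) → fourthRoot K ≤ C * (z * ℓ) := fun K hK =>
    hinv z _ hz0 (one_le_fourthRoot K)
      (hmethod.fourthRoot_le hN hF hlmo hf hstar hc hZ hlaw hind hε hK)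
  -- If no iterate were stationary, the bound on `fourthRoot K` would hold for every `K`, although
  -- `fourthRoot K ^ 4 = K + 1` is unbounded.
  have hex : ∃ k, g k ≤ ε := by
    by_contra! hcon
    obtain ⟨K, hK⟩ := exists_nat_gt ((C * (z * ℓ)) ^ 4)
    have h1 := hbound K fun k _ => hcon k
    have h2 : fourthRoot K ^ 4 ≤ (C * (z * ℓ)) ^ 4 := by
      have := fourthRoot_pos K
      gcongr
    rw [fourthRoot_pow_four] at h2
    linarith
  classical
  set K := Nat.find hex with hK
  have hKmin : ∀ k < K, ε < g k := fun k hk => not_le.1 (Nat.find_min hex hk)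
  have hreach : ∃ e, (sysRun τ p.R w e).updates = K :=
    (exists_accepting_arrival hτ hR1 hR K).imp fun _ h => h.1
  set e := Nat.find hreach with he
  have hestat : ∀ e', IsEpsStationary N (objective 𝒟 F) P ε
      (fun ω => (optRun p lmo F x₀ m₀ τ w (fun i k => ξ i k ω) e').x) ↔
      g (sysRun τ p.R w e').updates ≤ ε := by
    intro e'
    simp only [IsEpsStationary, hrun]
    exact ⟨fun h => h.2, fun h => ⟨hint _, h⟩⟩
  refine ⟨K, (sysRun τ p.R w e).clock, ⟨⟨e, Nat.find_spec hreach, ?_⟩, ?_⟩,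
    ⟨e, ⟨Nat.find_spec hreach, fun e' he' => Nat.find_min' hreach he'⟩, rfl⟩, ?_⟩
  · rw [hestat, Nat.find_spec hreach]
    exact Nat.find_spec hex
  · rintro k ⟨e', rfl, he'⟩
    exact Nat.find_min' hex ((hestat e').1 he')
  have hupd : (sysRun τ p.R w e).updates = K := Nat.find_spec hreach
  rw [Real.mul_iInf_of_nonneg (by positivity)]
  have : Nonempty (Fin n) := ⟨w 0⟩
  refine le_ciInf fun m => ?_
  have hH := (harmonicMean_pos hτ m).le
  have hm : (0 : ℝ) < (m : ℕ) + 1 := by positivity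
  -- For `K = 0` the clock still shows `0`. Otherwise `K = j + 1` with no stationary iterate up to
  -- `j`, so the bound applies to `fourthRoot j`, whose fourth power is exactly `K`.
  rcases Nat.eq_zero_or_pos K with hK0 | hKpos
  · have he0 : e = 0 := Nat.le_zero.1 (Nat.find_min' hreach (by rw [hK0]; rfl))
    rw [he0]
    change (0 : ℝ) ≤ _
    positivity
  obtain ⟨j, hj⟩ : ∃ j, K = j + 1 := ⟨K - 1, by omega⟩
  have hy := hbound j fun k hk => hKmin k (by omega)
  have hclock := sysRun_clock_le hτ hw hR1 hR m e
  rw [hupd, hj, sqrt_succ_eq] at hclock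
  push_cast at hclock
  rw [← fourthRoot_pow_four] at hclock
  refine hclock.trans ((iteration_bound_le hH (one_le_fourthRoot j) hy rfl hC hm).trans
    (le_of_eq ?_))
  rw [hz]
  field_simp
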